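/- Let $d=1$ or $d=2$, and let $K\subset\mathbb{R}^d$ be a centrally symmetric convex body, i.e. a compact convex set with nonempty interior and $K=-K$. For a locally integrable function $f:\mathbb{R}^d\to\mathbb{R}$ let $$Mf(x)=\sup_{\lambda>0}\frac{1}{|x+\lambda K|}\int_{x+\lambda K}|f(y)|\,dy$$ be the centered maximal function associated to $K$, where $|S|$ denotes the Lebesgue measure of $S$. Then for every $1<p<\infty$ there is a constant $\varepsilon=\varepsilon(K,p)>0$ such that $$\|Mf\|_p\ge(1+\varepsilon)\|f\|_p\qquad\text{for all } f\in L^p(\mathbb{R}^d).$$ -/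

import Mathlib

open MeasureTheory
open scoped ENNReal Pointwise

/-- The centered maximal function of a nonnegative function `f` associated to the set `K`:
the supremum over all `r > 0` of the average of `f` over `x + r K`. -/
noncomputable def centeredMaximal {d : ℕ} (K : Set (EuclideanSpace ℝ (Fin d)))
    (f : EuclideanSpace ℝ (Fin d) → ℝ≥0∞) (x : EuclideanSpace ℝ (Fin d)) : ℝ≥0∞ :=
  ⨆ (r : ℝ) (_ : 0 < r), ⨍⁻ y in x +ᵥ r • K, f y ∂volume

/-! Let g = Mf - f, which is nonnegative almost everywhere by Lebesgue differentiation. Sublinearity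
and the strong (p, p) bound give M^k f ≤ f + h with ∫ h^p ≤ D ∫ g^p, where D depends only on K, p
and k (`exists_iterate_le_add`). If some k depending only on K and p makes ‖M^k f‖_p ≥ 2 ‖f‖_p
(`exists_iterate_lintegral_ge`), then ∫ f^p ≤ D ∫ g^p, and (f + g)^p ≥ f^p + g^p yields the gain.

By the layer cake formula the doubling reduces to indicators of sets S
(`exists_iterate_measure_ge`). Around almost every point of S take a nearly largest dilate in which
S has density at least θ. A Vitali selection of these is disjoint, and S has density below θ in the
fivefold enlargements, so the selected dilates have total measure at least |S| / (θ 5^d). On each of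
them a bounded number of iterations lifts M^k 1_S to 1/2 (`exists_iterate_ge_half`).

That last fact is where d ≤ 2 enters, through a form of recurrence: M^k 1_K comes close to 1 on 3K
(`exists_iterate_indicator_ge`). In coordinates L making the covariance of K the identity,
|Lx|^(-2s) is strictly subharmonic for every s > 0, because 2s + 2 - d > 0. Its averages over
dilates of size c|Lx| gain a factor 1 + κ (`exists_subharmonic`). Comparison bounds M^k 1_K below by
a normalised such power up to an error (1 + κ)^(-k), and letting s tend to 0 makes the power close
to 1 on 3K. -/

open Set Metric Filter Module
open scoped Topology NNReal

set_option linter.unusedSectionVars false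

/-! ### Maximal averages, dilates of K, Vitali covering and differentiation. -/

section Basics

variable {E : Type*} [NormedAddCommGroup E] [InnerProductSpace ℝ E] [FiniteDimensional ℝ E]
  [MeasurableSpace E] [BorelSpace E]

/-- A centrally symmetric convex body: a compact convex symmetric neighbourhood of the origin. -/
structure IsSymmBody (K : Set E) : Prop where
  convex : Convex ℝ K
  compact : IsCompact K
  symm : ∀ x ∈ K, -x ∈ K
  mem_nhds : K ∈ 𝓝 (0 : E)

/-- The uniform probability measure on `K`. -/
noncomputable def unif (μ : Measure E) (K : Set E) : Measure E := (μ K)⁻¹ • μ.restrict K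

/-- The supremum over `r > 0` of the averages of `f` against the image of `ν` under
`y ↦ x + r • y`. -/
noncomputable def maxAvg (ν : Measure E) (f : E → ℝ≥0∞) (x : E) : ℝ≥0∞ :=
  ⨆ (r : ℝ) (_ : 0 < r), ∫⁻ y, f (x + r • y) ∂ν

variable (ν : Measure E)

lemma le_maxAvg (f : E → ℝ≥0∞) (x : E) {r : ℝ} (hr : 0 < r) :
    ∫⁻ y, f (x + r • y) ∂ν ≤ maxAvg ν f x :=
  le_iSup₂_of_le r hr le_rfl

lemma maxAvg_mono : Monotone (maxAvg ν) := fun _ _ h _ =>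
  iSup₂_mono fun _ _ => lintegral_mono fun _ => h _

lemma maxAvg_const_mul {c : ℝ≥0∞} (hc : c ≠ ∞) (f : E → ℝ≥0∞) :
    maxAvg ν (fun x => c * f x) = fun x => c * maxAvg ν f x := by
  funext x
  simp only [maxAvg, ENNReal.mul_iSup]
  refine iSup_congr fun r => iSup_congr fun _ => ?_
  rw [lintegral_const_mul' _ _ hc]

lemma maxAvg_iterate_const_mul {c : ℝ≥0∞} (hc : c ≠ ∞) (k : ℕ) (f : E → ℝ≥0∞) :
    (maxAvg ν)^[k] (fun x => c * f x) = fun x => c * (maxAvg ν)^[k] f x := by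
  induction k with
  | zero => rfl
  | succ k ih => rw [Function.iterate_succ_apply', ih, maxAvg_const_mul ν hc,
      Function.iterate_succ_apply']

lemma maxAvg_add_le {f : E → ℝ≥0∞} (hf : Measurable f) (g : E → ℝ≥0∞) (x : E) :
    maxAvg ν (fun y => f y + g y) x ≤ maxAvg ν f x + maxAvg ν g x := by
  refine iSup₂_le fun r hr => ?_
  rw [lintegral_add_left (by fun_prop)]
  exact add_le_add (le_maxAvg ν f x hr) (le_maxAvg ν g x hr)

/-- Dilations and translations commute with the maximal operator. -/
lemma maxAvg_comp_affine (f : E → ℝ≥0∞) (x₀ : E) {r₀ : ℝ} (h₀ : 0 < r₀) (x : E) :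
    maxAvg ν (fun y => f (x₀ + r₀ • y)) x ≤ maxAvg ν f (x₀ + r₀ • x) := by
  refine iSup₂_le fun r hr => ?_
  refine le_trans (le_of_eq ?_) (le_maxAvg ν f (x₀ + r₀ • x) (mul_pos h₀ hr))
  refine lintegral_congr fun y => ?_
  beta_reduce
  rw [smul_add, smul_smul, add_assoc]

lemma maxAvg_iterate_comp_affine (f : E → ℝ≥0∞) (x₀ : E) {r₀ : ℝ} (h₀ : 0 < r₀) (k : ℕ) (x : E) :
    (maxAvg ν)^[k] (fun y => f (x₀ + r₀ • y)) x ≤ (maxAvg ν)^[k] f (x₀ + r₀ • x) := by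
  induction k generalizing x with
  | zero => rfl
  | succ k ih =>
    rw [Function.iterate_succ_apply', Function.iterate_succ_apply']
    exact (maxAvg_mono ν (fun y => ih y) x).trans (maxAvg_comp_affine ν _ x₀ h₀ x)

variable {ν} {μ : Measure E} [μ.IsAddHaarMeasure] {K : Set E}

lemma mem_dilate {x z : E} {r : ℝ} : z ∈ x +ᵥ r • K ↔ ∃ k ∈ K, x + r • k = z := by
  simp only [mem_vadd_set, mem_smul_set]
  constructor
  · rintro ⟨_, ⟨k, hk, rfl⟩, rfl⟩; exact ⟨k, hk, rfl⟩
  · rintro ⟨k, hk, rfl⟩; exact ⟨_, ⟨k, hk, rfl⟩, rfl⟩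

lemma measure_dilate (x : E) {r : ℝ} (hr : 0 ≤ r) :
    μ (x +ᵥ r • K) = ENNReal.ofReal (r ^ finrank ℝ E) * μ K := by
  rw [measure_vadd, Measure.addHaar_smul_of_nonneg μ hr]

lemma lintegral_unif (f : E → ℝ≥0∞) (x : E) {r : ℝ} (hr : 0 < r) :
    ∫⁻ y, f (x + r • y) ∂unif μ K = (μ (x +ᵥ r • K))⁻¹ * ∫⁻ y in x +ᵥ r • K, f y ∂μ := by
  let e : E ≃ᵐ E :=
    ((Homeomorph.smulOfNeZero r hr.ne').trans (Homeomorph.addLeft x)).toMeasurableEquiv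
  have he : ∀ y, e y = x + r • y := fun y => rfl
  have hmap : μ.map e = ENNReal.ofReal ((r ^ finrank ℝ E)⁻¹) • μ := by
    have : (e : E → E) = (x + ·) ∘ (r • ·) := rfl
    rw [this, ← Measure.map_map (by fun_prop) (by fun_prop), Measure.map_addHaar_smul μ hr.ne',
      Measure.map_smul, map_add_left_eq_self, abs_of_pos (by positivity)]
  have hpre : e ⁻¹' (x +ᵥ r • K) = K := by
    ext y
    rw [mem_preimage, he, mem_dilate]
    constructor
    · rintro ⟨k, hk, h⟩
      rwa [← smul_right_injective E hr.ne' (add_left_cancel h)]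
    · exact fun h => ⟨y, h, rfl⟩
  have key : ∫⁻ y in K, f (x + r • y) ∂μ
      = ENNReal.ofReal ((r ^ finrank ℝ E)⁻¹) * ∫⁻ y in x +ᵥ r • K, f y ∂μ := by
    have := e.measurableEmbedding.lintegral_map (μ := μ.restrict K) f
    simp only [he] at this
    rw [← this]
    conv_lhs => rw [← hpre]
    rw [← e.restrict_map, hmap, Measure.restrict_smul, lintegral_smul_measure, smul_eq_mul]
  rw [unif, lintegral_smul_measure, key, measure_dilate x hr.le, smul_eq_mul, ← mul_assoc,
    ENNReal.mul_inv (Or.inl (by simp; positivity)) (Or.inl ENNReal.ofReal_ne_top),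
    ENNReal.ofReal_inv_of_pos (by positivity), mul_comm (μ K)⁻¹]

lemma lintegral_unif_mono_ae {f g : E → ℝ≥0∞} (h : f ≤ᵐ[μ] g) (x : E) {r : ℝ} (hr : 0 < r) :
    ∫⁻ y, f (x + r • y) ∂unif μ K ≤ ∫⁻ y, g (x + r • y) ∂unif μ K := by
  rw [lintegral_unif _ _ hr, lintegral_unif _ _ hr]
  gcongr 1
  exact lintegral_mono_ae (ae_restrict_of_ae h)

lemma maxAvg_mono_ae {f g : E → ℝ≥0∞} (h : f ≤ᵐ[μ] g) :
    maxAvg (unif μ K) f ≤ maxAvg (unif μ K) g := by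
  intro x
  exact iSup₂_le fun r hr => (lintegral_unif_mono_ae h x hr).trans (le_maxAvg _ g x hr)

namespace IsSymmBody

variable (hK : IsSymmBody K)
include hK

lemma zero_mem : (0 : E) ∈ K := mem_of_mem_nhds hK.mem_nhds

lemma measure_pos : 0 < μ K := Measure.measure_pos_of_mem_nhds μ hK.mem_nhds

lemma measure_ne_zero : μ K ≠ 0 := (hK.measure_pos).ne'

lemma measure_ne_top : μ K ≠ ∞ := hK.compact.measure_ne_top

lemma isProbabilityMeasure_unif : IsProbabilityMeasure (unif μ K) := by
  constructor
  rw [unif, Measure.smul_apply, Measure.restrict_apply_univ, smul_eq_mul,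
    ENNReal.inv_mul_cancel hK.measure_ne_zero hK.measure_ne_top]

lemma compact_dilate (x : E) (r : ℝ) : IsCompact (x +ᵥ r • K) := (hK.compact.smul r).vadd x

lemma measurableSet_dilate (x : E) (r : ℝ) : MeasurableSet (x +ᵥ r • K) :=
  (hK.compact_dilate x r).measurableSet

lemma measure_dilate_ne_zero (x : E) {r : ℝ} (hr : 0 < r) : μ (x +ᵥ r • K) ≠ 0 := by
  rw [measure_dilate x hr.le]
  exact mul_ne_zero (by simp; positivity) hK.measure_ne_zero

lemma measure_dilate_ne_top (x : E) (r : ℝ) : μ (x +ᵥ r • K) ≠ ∞ :=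
  (hK.compact_dilate x r).measure_ne_top

lemma self_mem_dilate (x : E) (r : ℝ) : x ∈ x +ᵥ r • K :=
  mem_dilate.2 ⟨0, hK.zero_mem, by simp⟩

/-- A point within `K`-distance `ρ` of `x` has its `r`-dilate contained in the `ρ + r`-dilate
at `x`. -/
lemma dilate_subset {x z : E} {r ρ s : ℝ} (hρ : 0 ≤ ρ) (hr : 0 ≤ r) (h : ρ + r ≤ s)
    (hz : z ∈ x +ᵥ ρ • K) : z +ᵥ r • K ⊆ x +ᵥ s • K := by
  intro w hw
  obtain ⟨k, hk, rfl⟩ := mem_dilate.1 hz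
  obtain ⟨l, hl, rfl⟩ := mem_dilate.1 hw
  obtain ⟨m, hm, hm'⟩ := hK.convex.exists_mem_add_smul_eq hk hl hρ hr
  rcases (add_nonneg hρ hr).eq_or_lt with h0 | h0
  · exact mem_dilate.2 ⟨0, hK.zero_mem, by rw [add_assoc, ← hm', ← h0]; simp⟩
  · have hs : 0 < s := h0.trans_le h
    refine mem_dilate.2 ⟨((ρ + r) / s) • m, ?_, ?_⟩
    · exact hK.convex.smul_mem_of_zero_mem hK.zero_mem hm
        ⟨by positivity, (div_le_one hs).2 h⟩
    · rw [smul_smul, mul_div_cancel₀ _ hs.ne', hm', add_assoc]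

lemma mem_dilate_comm {x z : E} {r : ℝ} (h : z ∈ x +ᵥ r • K) : x ∈ z +ᵥ r • K := by
  obtain ⟨k, hk, rfl⟩ := mem_dilate.1 h
  exact mem_dilate.2 ⟨-k, hK.symm k hk, by simp⟩

lemma dilate_mem_nhds (x : E) {r : ℝ} (hr : 0 < r) : x +ᵥ r • K ∈ 𝓝 x := by
  have h1 : r • K ∈ 𝓝 (0 : E) := (set_smul_mem_nhds_zero_iff hr.ne').2 hK.mem_nhds
  have := (vadd_mem_nhds_vadd_iff x (a := (0 : E))).2 h1
  simpa using this

/-- Vitali covering by dilates of a symmetric convex body. -/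
lemma exists_disjoint_covering (T : Set E) (r : E → ℝ) (hr : ∀ x ∈ T, 0 < r x) {R : ℝ}
    (hR : ∀ x ∈ T, r x ≤ R) :
    ∃ u ⊆ T, u.Countable ∧ u.PairwiseDisjoint (fun x => x +ᵥ r x • K) ∧
      T ⊆ ⋃ x ∈ u, x +ᵥ (5 * r x) • K := by
  obtain ⟨u, huT, hd, hc⟩ := Vitali.exists_disjoint_subfamily_covering_enlargement
    (fun x => x +ᵥ r x • K) T r 2 one_lt_two (fun x hx => (hr x hx).le) R hR
    (fun x _ => ⟨x, hK.self_mem_dilate x _⟩)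
  refine ⟨u, huT, ?_, hd, ?_⟩
  · refine hd.countable_of_nonempty_interior fun x hx => ⟨x, ?_⟩
    exact mem_interior_iff_mem_nhds.2 (hK.dilate_mem_nhds x (hr x (huT hx)))
  · intro x hx
    obtain ⟨y, hy, ⟨z, hzx, hzy⟩, hxy⟩ := hc x hx
    refine mem_iUnion₂.2 ⟨y, hy, ?_⟩
    have h0 := hr x hx
    -- Only the centre x has to be covered, so `r y + r x ≤ 3 * r y` already suffices; the factor 5
    -- leaves room.
    exact hK.dilate_subset (hr y (huT hy)).le h0.le (by linarith) hzy (hK.mem_dilate_comm hzx)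

lemma exists_dilate_subset_of_lt (x : E) {r s : ℝ} (hr : 0 ≤ r) (h : r < s) :
    ∀ᶠ z in 𝓝 x, x +ᵥ r • K ⊆ z +ᵥ s • K := by
  filter_upwards [hK.dilate_mem_nhds x (sub_pos.2 h)] with z hz
  exact hK.dilate_subset (sub_pos.2 h).le hr (by linarith) (hK.mem_dilate_comm hz)

/-- An average above t over x + rK stays above t after dividing by the volume of a slightly larger
dilate, and that larger dilate centred at any z near x contains x + rK. -/
lemma lowerSemicontinuous_maxAvg (f : E → ℝ≥0∞) : LowerSemicontinuous (maxAvg (unif μ K) f) := by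
  intro x t ht
  obtain ⟨r, hr, h⟩ : ∃ r : ℝ, ∃ _ : 0 < r, t < ∫⁻ y, f (x + r • y) ∂unif μ K := by
    simpa only [maxAvg, lt_iSup_iff] using ht
  rw [lintegral_unif _ _ hr] at h
  have hcont : Tendsto (fun s : ℝ => (μ (x +ᵥ s • K))⁻¹ * ∫⁻ y in x +ᵥ r • K, f y ∂μ) (𝓝[>] r)
      (𝓝 ((μ (x +ᵥ r • K))⁻¹ * ∫⁻ y in x +ᵥ r • K, f y ∂μ)) := by
    refine ENNReal.Tendsto.mul_const ?_
      (Or.inl (ENNReal.inv_ne_zero.2 (hK.measure_dilate_ne_top x r)))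
    refine tendsto_inv_iff.2 ?_
    have h1 : Tendsto (fun s : ℝ => ENNReal.ofReal (s ^ finrank ℝ E) * μ K) (𝓝[>] r)
        (𝓝 (ENNReal.ofReal (r ^ finrank ℝ E) * μ K)) := by
      refine ENNReal.Tendsto.mul_const ?_ (Or.inr hK.measure_ne_top)
      refine ENNReal.tendsto_ofReal (Tendsto.mono_left ?_ nhdsWithin_le_nhds)
      exact (continuous_pow _).tendsto r
    rw [measure_dilate x hr.le]
    refine h1.congr' ?_
    filter_upwards [self_mem_nhdsWithin] with s hs
    rw [measure_dilate x (hr.trans hs).le]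
  obtain ⟨s, hs, hrs⟩ := ((hcont.eventually (lt_mem_nhds h)).and self_mem_nhdsWithin).exists
  have hs0 : 0 < s := hr.trans hrs
  filter_upwards [hK.exists_dilate_subset_of_lt x hr.le hrs] with z hz
  refine hs.trans_le (le_trans ?_ (le_maxAvg _ f z hs0))
  rw [lintegral_unif _ _ hs0, measure_dilate x hs0.le, measure_dilate z hs0.le]
  gcongr

lemma measurable_maxAvg (f : E → ℝ≥0∞) : Measurable (maxAvg (unif μ K) f) :=
  (hK.lowerSemicontinuous_maxAvg f).measurable

/-- Lebesgue differentiation along the dilates x + rK, which are comparable in measure to balls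
containing them. -/
lemma ae_le_maxAvg_of_integrable {f : E → ℝ≥0∞} (hf : Measurable f) (hfi : ∫⁻ x, f x ∂μ ≠ ∞) :
    ∀ᵐ x ∂μ, f x ≤ maxAvg (unif μ K) f x := by
  obtain ⟨R₀, hR₀⟩ := hK.compact.isBounded.subset_closedBall (0 : E)
  set R := max R₀ 1 with hRdef
  have hR : 0 < R := lt_max_of_lt_right one_pos
  have hKR : K ⊆ closedBall (0 : E) R := hR₀.trans (closedBall_subset_closedBall (le_max_left _ _))
  -- The first summand compares a ball containing a dilate of K with that dilate; the `+ 1` ensures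
  -- C ≥ 3^d, the doubling constant of balls.
  set C : ℝ≥0 := (ENNReal.ofReal (3 ^ finrank ℝ E) *
    (ENNReal.ofReal (R ^ finrank ℝ E) * μ (closedBall 0 1) * (μ K)⁻¹ + 1)).toNNReal with hC
  have hC' : (C : ℝ≥0∞) = ENNReal.ofReal (3 ^ finrank ℝ E) *
    (ENNReal.ofReal (R ^ finrank ℝ E) * μ (closedBall 0 1) * (μ K)⁻¹ + 1) := by
    refine ENNReal.coe_toNNReal (ENNReal.mul_ne_top ENNReal.ofReal_ne_top
      (ENNReal.add_ne_top.2 ⟨ENNReal.mul_ne_top (ENNReal.mul_ne_top ENNReal.ofReal_ne_top ?_) ?_,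
        ENNReal.one_ne_top⟩))
    · exact (isCompact_closedBall _ _).measure_ne_top
    · exact ENNReal.inv_ne_top.2 hK.measure_ne_zero
  have hball : ∀ (x : E) (r : ℝ), 0 < r → μ (closedBall x (3 * r))
      = ENNReal.ofReal (3 ^ finrank ℝ E) * μ (closedBall x r) := by
    intro x r hr
    rw [Measure.addHaar_closedBall' μ x (by positivity), Measure.addHaar_closedBall' μ x hr.le,
      mul_pow, ENNReal.ofReal_mul (by positivity), mul_assoc]
  let v := Vitali.vitaliFamily μ C (by
    intro x
    refine Eventually.frequently ?_
    filter_upwards [self_mem_nhdsWithin] with r hr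
    rw [hball x r hr, hC']
    gcongr
    exact le_mul_of_one_le_right' le_add_self)
  filter_upwards [v.ae_tendsto_lintegral_div' hf hfi] with x hx
  have hlim : Tendsto (fun r : ℝ => x +ᵥ r • K) (𝓝[>] 0) (v.filterAt x) := by
    rw [v.tendsto_filterAt_iff]
    have hsub : ∀ r : ℝ, 0 < r → x +ᵥ r • K ⊆ closedBall x (r * R) := by
      intro r hr z hz
      obtain ⟨k, hk, rfl⟩ := mem_dilate.1 hz
      have := hKR hk
      simp only [mem_closedBall, dist_zero_right] at this
      simp only [mem_closedBall, dist_self_add_left, norm_smul, Real.norm_of_nonneg hr.le]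
      gcongr
    constructor
    · filter_upwards [self_mem_nhdsWithin] with r hr
      have hr : 0 < r := hr
      refine ⟨(hK.compact_dilate x r).isClosed, ⟨x, ?_⟩, r * R, hsub r hr, ?_⟩
      · exact mem_interior_iff_mem_nhds.2 (hK.dilate_mem_nhds x hr)
      · rw [hball x _ (by positivity), Measure.addHaar_closedBall' μ x (by positivity),
          measure_dilate x hr.le, hC', mul_pow, ENNReal.ofReal_mul (by positivity), mul_assoc,
          mul_assoc, mul_assoc]
        gcongr 1
        have : (μ K)⁻¹ * μ K = 1 :=
          ENNReal.inv_mul_cancel hK.measure_ne_zero hK.measure_ne_top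
        calc ENNReal.ofReal (r ^ finrank ℝ E) *
              (ENNReal.ofReal (R ^ finrank ℝ E) * μ (closedBall 0 1))
            = (ENNReal.ofReal (R ^ finrank ℝ E) * μ (closedBall 0 1)) * ((μ K)⁻¹ * μ K)
              * ENNReal.ofReal (r ^ finrank ℝ E) := by rw [this]; ring
          _ = (ENNReal.ofReal (R ^ finrank ℝ E) * (μ (closedBall 0 1) * (μ K)⁻¹)) *
              (ENNReal.ofReal (r ^ finrank ℝ E) * μ K) := by ring
          _ ≤ _ := by gcongr; exact le_self_add
    · intro ε hε
      have : Tendsto (fun r : ℝ => r * R) (𝓝[>] 0) (𝓝 0) := by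
        refine Tendsto.mono_left ?_ nhdsWithin_le_nhds
        exact (continuous_mul_const R).tendsto' 0 0 (zero_mul R)
      filter_upwards [this.eventually (ge_mem_nhds hε), self_mem_nhdsWithin] with r h1 hr
      exact (hsub r hr).trans (closedBall_subset_closedBall h1)
  refine le_of_tendsto (hx.comp hlim) ?_
  filter_upwards [self_mem_nhdsWithin] with r hr
  refine le_trans (le_of_eq ?_) (le_maxAvg _ f x hr)
  rw [lintegral_unif _ _ hr, ← ENNReal.div_eq_inv_mul]
  rfl

/-- The maximal function dominates the function almost everywhere. -/
lemma ae_le_maxAvg {f : E → ℝ≥0∞} (hf : Measurable f) :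
    ∀ᵐ x ∂μ, f x ≤ maxAvg (unif μ K) f x := by
  let F : ℕ → E → ℝ≥0∞ := fun n => (closedBall (0 : E) n).indicator fun x => min (f x) n
  have hF : ∀ n, Measurable (F n) := fun n =>
    (hf.min measurable_const).indicator isClosed_closedBall.measurableSet
  have hFi : ∀ n, ∫⁻ x, F n x ∂μ ≠ ∞ := by
    intro n
    refine ne_top_of_le_ne_top (b := n * μ (closedBall (0 : E) n)) ?_ ?_
    · exact ENNReal.mul_ne_top (ENNReal.natCast_ne_top n)
        (isCompact_closedBall _ _).measure_ne_top
    · rw [lintegral_indicator isClosed_closedBall.measurableSet]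
      refine (lintegral_mono fun x => min_le_right _ _).trans ?_
      simp
  have hFf : ∀ n, F n ≤ f := fun n x =>
    indicator_apply_le' (fun _ => min_le_left _ _) (fun _ => zero_le)
  filter_upwards [ae_all_iff.2 fun n => hK.ae_le_maxAvg_of_integrable (μ := μ) (hF n) (hFi n)]
    with x hx
  have hbound : ∀ n : ℕ, ‖x‖ ≤ n → min (f x) n ≤ maxAvg (unif μ K) f x := by
    intro n hn
    refine le_trans (le_of_eq ?_) ((hx n).trans (maxAvg_mono _ (hFf n) x))
    simp only [F]
    rw [indicator_of_mem (by simpa using hn)]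
  obtain ⟨N, hN⟩ := exists_nat_ge ‖x‖
  refine le_of_tendsto' (x := (atTop : Filter ℕ)) (f := fun n : ℕ => min (f x) ((n + N : ℕ) : ℝ≥0∞))
    ?_ fun n => hbound _ (hN.trans (by exact_mod_cast Nat.le_add_left _ _))
  have h1 : Tendsto (fun n : ℕ => ((n + N : ℕ) : ℝ≥0∞)) atTop (𝓝 ∞) :=
    ENNReal.tendsto_nat_nhds_top.comp (tendsto_add_atTop_nat N)
  simpa using (tendsto_const_nhds (x := f x)).min h1

end IsSymmBody

end Basics

/-! ### The layer cake formula. -/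

section LayerCake

lemma lintegral_Ioo_rpow {q : ℝ} (hq : 0 < q) {a : ℝ} (ha : 0 ≤ a) :
    ∫⁻ t in Ioo (0 : ℝ) a, ENNReal.ofReal (q * t ^ (q - 1)) = ENNReal.ofReal (a ^ q) := by
  have hInt : IntervalIntegrable (fun t : ℝ => q * t ^ (q - 1)) volume 0 a :=
    (intervalIntegral.intervalIntegrable_rpow' (by linarith)).const_mul q
  rw [Measure.restrict_congr_set Ioo_ae_eq_Ioc, ← ofReal_integral_eq_lintegral_ofReal
    ((intervalIntegrable_iff_integrableOn_Ioc_of_le ha).1 hInt)]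
  · rw [← intervalIntegral.integral_of_le ha, intervalIntegral.integral_const_mul,
      integral_rpow (Or.inl (by linarith)), sub_add_cancel, Real.zero_rpow hq.ne', sub_zero,
      mul_div_cancel₀ _ hq.ne']
  · filter_upwards [ae_restrict_mem measurableSet_Ioc] with t ht
    have := ht.1
    simp only [Pi.zero_apply]
    positivity

lemma lintegral_indicator_rpow {q : ℝ} (hq : 0 < q) (v : ℝ≥0∞) :
    ∫⁻ t in Ioi (0 : ℝ), {t : ℝ | ENNReal.ofReal t < v}.indicator
      (fun t => ENNReal.ofReal (q * t ^ (q - 1))) t = v ^ q := by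
  have hmeas : MeasurableSet {t : ℝ | ENNReal.ofReal t < v} :=
    measurableSet_lt ENNReal.measurable_ofReal measurable_const
  rw [lintegral_indicator hmeas, Measure.restrict_restrict hmeas]
  rcases eq_or_ne v ∞ with rfl | hv
  · rw [ENNReal.top_rpow_of_pos hq, eq_top_iff]
    have hlim : Tendsto (fun n : ℕ => ENNReal.ofReal ((n : ℝ) ^ q)) atTop (𝓝 ∞) :=
      ENNReal.tendsto_ofReal_atTop.comp ((tendsto_rpow_atTop hq).comp tendsto_natCast_atTop_atTop)
    refine le_of_tendsto' hlim fun n => ?_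
    rw [← lintegral_Ioo_rpow hq (Nat.cast_nonneg n)]
    exact lintegral_mono_set fun t ht => ⟨ENNReal.ofReal_lt_top, ht.1⟩
  · have : {t : ℝ | ENNReal.ofReal t < v} ∩ Ioi 0 = Ioo 0 v.toReal := by
      ext t
      simp only [mem_inter_iff, mem_ofPred_eq, mem_Ioi, mem_Ioo]
      constructor
      · exact fun h => ⟨h.2, (ENNReal.ofReal_lt_iff_lt_toReal h.2.le hv).1 h.1⟩
      · exact fun h => ⟨(ENNReal.ofReal_lt_iff_lt_toReal h.1.le hv).2 h.2, h.1⟩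
    rw [this, lintegral_Ioo_rpow hq ENNReal.toReal_nonneg,
      ← ENNReal.ofReal_rpow_of_nonneg ENNReal.toReal_nonneg hq.le, ENNReal.ofReal_toReal hv]

/-- Layer cake formula for extended nonnegative functions. -/
lemma lintegral_rpow_eq_lintegral_measure_lt {α : Type*} [MeasurableSpace α] (m : Measure α)
    [SFinite m] {u : α → ℝ≥0∞} (hu : Measurable u) {q : ℝ} (hq : 0 < q) :
    ∫⁻ x, u x ^ q ∂m = ∫⁻ t in Ioi (0 : ℝ),
      m {x | ENNReal.ofReal t < u x} * ENNReal.ofReal (q * t ^ (q - 1)) := by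
  have hS : MeasurableSet {z : α × ℝ | ENNReal.ofReal z.2 < u z.1} :=
    measurableSet_lt (ENNReal.measurable_ofReal.comp measurable_snd) (hu.comp measurable_fst)
  calc ∫⁻ x, u x ^ q ∂m
      = ∫⁻ x, (∫⁻ t in Ioi (0 : ℝ), {z : α × ℝ | ENNReal.ofReal z.2 < u z.1}.indicator
          (fun z => ENNReal.ofReal (q * z.2 ^ (q - 1))) (x, t)) ∂m := by
        refine lintegral_congr fun x => ?_
        rw [← lintegral_indicator_rpow hq (u x)]
        rfl
    _ = ∫⁻ t in Ioi (0 : ℝ), ∫⁻ x, {z : α × ℝ | ENNReal.ofReal z.2 < u z.1}.indicator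
          (fun z => ENNReal.ofReal (q * z.2 ^ (q - 1))) (x, t) ∂m := by
        refine lintegral_lintegral_swap ?_
        refine (Measurable.indicator ?_ hS).aemeasurable
        fun_prop
    _ = _ := by
        refine lintegral_congr fun t => ?_
        have hm : MeasurableSet {x | ENNReal.ofReal t < u x} :=
          measurableSet_lt measurable_const hu
        have : ∀ x, {z : α × ℝ | ENNReal.ofReal z.2 < u z.1}.indicator
          (fun z => ENNReal.ofReal (q * z.2 ^ (q - 1))) (x, t)
            = {x | ENNReal.ofReal t < u x}.indicator
              (fun _ => ENNReal.ofReal (q * t ^ (q - 1))) x := fun x => rfl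
        simp only [this]
        rw [lintegral_indicator hm, setLIntegral_const, mul_comm]

end LayerCake

/-- Since r ≤ r^n for r ≥ 1, a volume bound limits the radii, as the covering argument requires. -/
lemma le_max_of_ofReal_pow_mul_le {n : ℕ} (hn : n ≠ 0) {r : ℝ} {a b : ℝ≥0∞} (ha : a ≠ 0)
    (ha' : a ≠ ∞) (hb : b ≠ ∞) (h : ENNReal.ofReal (r ^ n) * a ≤ b) :
    r ≤ max 1 (b / a).toReal := by
  rcases le_total r 1 with h1 | h1
  · exact h1.trans (le_max_left _ _)
  · refine (le_self_pow₀ h1 hn).trans ((le_trans ?_) (le_max_right _ _))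
    refine (ENNReal.ofReal_le_iff_le_toReal (ENNReal.div_ne_top hb ha)).1 ?_
    exact (ENNReal.le_div_iff_mul_le (Or.inl ha) (Or.inl ha')).2 h

/-! ### Weak type (1, 1) and strong type (p, p) bounds. -/

section Maximal

variable {E : Type*} [NormedAddCommGroup E] [InnerProductSpace ℝ E] [FiniteDimensional ℝ E]
  [MeasurableSpace E] [BorelSpace E] {μ : Measure E} [μ.IsAddHaarMeasure] {K : Set E}

lemma measure_dilate_five (x : E) {r : ℝ} (hr : 0 ≤ r) :
    μ (x +ᵥ (5 * r) • K) = ENNReal.ofReal (5 ^ finrank ℝ E) * μ (x +ᵥ r • K) := by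
  rw [measure_dilate x (by positivity), measure_dilate x hr, mul_pow,
    ENNReal.ofReal_mul (by positivity), mul_assoc]

namespace IsSymmBody

variable (hK : IsSymmBody K)
include hK

/-- The weak type `(1, 1)` inequality. -/
lemma weak_type (hd : finrank ℝ E ≠ 0) (f : E → ℝ≥0∞) {t : ℝ≥0∞} (ht : t ≠ 0) (ht' : t ≠ ∞) :
    t * μ {x | t < maxAvg (unif μ K) f x} ≤
      ENNReal.ofReal (5 ^ finrank ℝ E) * ∫⁻ x, f x ∂μ := by
  have h5 : ENNReal.ofReal (5 ^ finrank ℝ E) ≠ 0 := by simp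
  rcases eq_or_ne (∫⁻ x, f x ∂μ) ∞ with hf | hf
  · rw [hf, ENNReal.mul_top h5]; exact le_top
  set T := {x | t < maxAvg (unif μ K) f x} with hT
  have hex : ∀ x, ∃ r : ℝ, x ∈ T → 0 < r ∧ t * μ (x +ᵥ r • K) ≤ ∫⁻ y in x +ᵥ r • K, f y ∂μ := by
    intro x
    by_cases hx : x ∈ T
    · obtain ⟨r, hr, h⟩ : ∃ r : ℝ, ∃ _ : 0 < r, t < ∫⁻ y, f (x + r • y) ∂unif μ K := by
        simpa only [hT, mem_ofPred_eq, maxAvg, lt_iSup_iff] using hx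
      refine ⟨r, fun _ => ⟨hr, ?_⟩⟩
      rw [lintegral_unif _ _ hr, ← ENNReal.div_eq_inv_mul] at h
      exact ENNReal.mul_le_of_le_div h.le
    · exact ⟨0, fun h => absurd h hx⟩
  choose r hr using hex
  have hμ0 : t * μ K ≠ 0 := mul_ne_zero ht hK.measure_ne_zero
  have hμt : t * μ K ≠ ∞ := ENNReal.mul_ne_top ht' hK.measure_ne_top
  obtain ⟨u, huT, hcount, hdisj, hcov⟩ := hK.exists_disjoint_covering T r (fun x hx => (hr x hx).1)
    (R := max 1 ((∫⁻ x, f x ∂μ) / (t * μ K)).toReal) (by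
      intro x hx
      refine le_max_of_ofReal_pow_mul_le hd hμ0 hμt hf ?_
      refine le_trans (le_of_eq ?_) ((hr x hx).2.trans (setLIntegral_le_lintegral _ _))
      rw [measure_dilate x (hr x hx).1.le]; ring)
  calc t * μ T ≤ t * ∑' x : u, μ ((x : E) +ᵥ (5 * r x) • K) := by
        gcongr
        exact (measure_mono hcov).trans (measure_biUnion_le μ hcount _)
    _ = ENNReal.ofReal (5 ^ finrank ℝ E) * ∑' x : u, t * μ ((x : E) +ᵥ r x • K) := by
        rw [ENNReal.tsum_mul_left, mul_left_comm,
          ← ENNReal.tsum_mul_left (a := ENNReal.ofReal (5 ^ finrank ℝ E))]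
        congr 1
        exact tsum_congr fun x => measure_dilate_five _ (hr x (huT x.2)).1.le
    _ ≤ ENNReal.ofReal (5 ^ finrank ℝ E) * ∑' x : u, ∫⁻ y in (x : E) +ᵥ r x • K, f y ∂μ := by
        gcongr with x
        exact (hr x (huT x.2)).2
    _ = ENNReal.ofReal (5 ^ finrank ℝ E) * ∫⁻ y in ⋃ x ∈ u, x +ᵥ r x • K, f y ∂μ := by
        rw [lintegral_biUnion hcount (fun x _ => hK.measurableSet_dilate x _) hdisj]
    _ ≤ _ := mul_le_mul_right (setLIntegral_le_lintegral _ _) _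

/-- The part of f that is at most t/2 contributes at most t/2 to the maximal function, so the weak
type bound is only needed for the part where 2f > t. -/
lemma measure_lt_maxAvg_le (hd : finrank ℝ E ≠ 0) {f : E → ℝ≥0∞} (hf : Measurable f) {t : ℝ}
    (ht : 0 < t) :
    μ {x | ENNReal.ofReal t < maxAvg (unif μ K) f x} ≤ ENNReal.ofReal (5 ^ finrank ℝ E * 2 / t) *
      ∫⁻ x in {x | ENNReal.ofReal t < 2 * f x}, f x ∂μ := by
  have := hK.isProbabilityMeasure_unif (μ := μ)
  set S := {x | ENNReal.ofReal t < 2 * f x} with hS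
  have hSm : MeasurableSet S := measurableSet_lt measurable_const (hf.const_mul 2)
  set τ := ENNReal.ofReal (t / 2) with hτ
  have hτ2 : 2 * τ = ENNReal.ofReal t := by
    rw [hτ, show (2 : ℝ≥0∞) = ENNReal.ofReal 2 by simp, ← ENNReal.ofReal_mul two_pos.le]
    congr 1; ring
  have hsplit : ∀ x, f x ≤ S.indicator f x + τ := by
    intro x
    by_cases hx : x ∈ S
    · rw [indicator_of_mem hx]; exact le_self_add
    · rw [indicator_of_notMem hx, zero_add]
      have : 2 * f x ≤ 2 * τ := by rw [hτ2]; exact not_lt.1 hx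
      exact (ENNReal.mul_le_mul_iff_right (by simp) (by simp)).1 this
  have hsub : {x | ENNReal.ofReal t < maxAvg (unif μ K) f x} ⊆
      {x | τ < maxAvg (unif μ K) (S.indicator f) x} := by
    intro x hx
    have h1 : maxAvg (unif μ K) f x ≤ maxAvg (unif μ K) (S.indicator f) x + τ := by
      refine (maxAvg_mono _ hsplit x).trans
        ((maxAvg_add_le _ (hf.indicator hSm) (fun _ => τ) x).trans ?_)
      gcongr
      exact iSup₂_le fun r _ => by simp
    have h2 := lt_of_lt_of_le hx h1
    rw [← hτ2, two_mul] at h2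
    exact lt_of_add_lt_add_right h2
  have hτ0 : τ ≠ 0 := by simp [hτ, ht]
  have hw := hK.weak_type (μ := μ) hd (S.indicator f) hτ0 ENNReal.ofReal_ne_top
  rw [lintegral_indicator hSm] at hw
  refine (measure_mono hsub).trans ?_
  rw [mul_comm, ← ENNReal.le_div_iff_mul_le (Or.inl hτ0) (Or.inl ENNReal.ofReal_ne_top)] at hw
  refine hw.trans (le_of_eq ?_)
  rw [div_eq_mul_inv, mul_right_comm, ← div_eq_mul_inv, hτ,
    ← ENNReal.ofReal_div_of_pos (by positivity)]
  congr 2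
  field_simp

/-- The strong type `(p, p)` inequality. -/
lemma strong_type (hd : finrank ℝ E ≠ 0) {p : ℝ} (hp : 1 < p) :
    ∃ C : ℝ≥0∞, C ≠ ∞ ∧ ∀ f : E → ℝ≥0∞, Measurable f →
      ∫⁻ x, maxAvg (unif μ K) f x ^ p ∂μ ≤ C * ∫⁻ x, f x ^ p ∂μ := by
  have hp0 : 0 < p := by linarith
  have hp1 : 0 < p - 1 := by linarith
  set A : ℝ := 5 ^ finrank ℝ E * 2 * p / (p - 1) with hA
  have hA0 : 0 ≤ A := by positivity
  refine ⟨ENNReal.ofReal A * 2 ^ (p - 1), ENNReal.mul_ne_top ENNReal.ofReal_ne_top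
    (ENNReal.rpow_ne_top_of_nonneg hp1.le (by simp)), fun f hf => ?_⟩
  have h2f : Measurable fun x => 2 * f x := hf.const_mul 2
  calc ∫⁻ x, maxAvg (unif μ K) f x ^ p ∂μ
      = ∫⁻ t in Ioi (0 : ℝ), μ {x | ENNReal.ofReal t < maxAvg (unif μ K) f x} *
          ENNReal.ofReal (p * t ^ (p - 1)) :=
        lintegral_rpow_eq_lintegral_measure_lt μ (hK.measurable_maxAvg f) hp0
    -- The factor 1/t from the weak bound lowers the weight to a multiple of t^(p-2), leaving the
    -- layer cake integral of (2f)^(p-1) against the measure f dμ.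
    _ ≤ ∫⁻ t in Ioi (0 : ℝ), ENNReal.ofReal A *
          (μ.withDensity f {x | ENNReal.ofReal t < 2 * f x} *
            ENNReal.ofReal ((p - 1) * t ^ (p - 1 - 1))) := by
        refine lintegral_mono_ae ?_
        filter_upwards [ae_restrict_mem measurableSet_Ioi] with t ht
        have ht : 0 < t := ht
        refine (mul_le_mul_left (hK.measure_lt_maxAvg_le hd hf ht) _).trans (le_of_eq ?_)
        rw [withDensity_apply _ (measurableSet_lt measurable_const h2f), mul_right_comm,
          ← ENNReal.ofReal_mul (by positivity), mul_comm (∫⁻ _ in _, f _ ∂μ),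
          ← mul_assoc (ENNReal.ofReal A), ← ENNReal.ofReal_mul hA0]
        congr 2
        rw [Real.rpow_sub_one ht.ne' (p - 1), hA]
        field_simp
    _ = ENNReal.ofReal A * ∫⁻ x, (2 * f x) ^ (p - 1) ∂μ.withDensity f := by
        rw [lintegral_const_mul' _ _ ENNReal.ofReal_ne_top,
          lintegral_rpow_eq_lintegral_measure_lt _ h2f hp1]
    _ = ENNReal.ofReal A * ∫⁻ x, 2 ^ (p - 1) * f x ^ p ∂μ := by
        rw [lintegral_withDensity_eq_lintegral_mul _ hf (h2f.pow_const _)]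
        congr 1
        refine lintegral_congr fun x => ?_
        simp only [Pi.mul_apply]
        rw [ENNReal.mul_rpow_of_nonneg _ _ hp1.le, mul_left_comm]
        congr 1
        have := ENNReal.rpow_add_of_nonneg (x := f x) 1 (p - 1) zero_le_one hp1.le
        rw [ENNReal.rpow_one] at this
        rw [← this]; congr 1; ring
    _ = _ := by
        rw [lintegral_const_mul _ (hf.pow_const p), mul_assoc]

end IsSymmBody

end Maximal

/-! ### A convexity estimate and isotropic position. -/

open scoped RealInnerProductSpace

/-- Near `t = 1` the power `t ^ (-s)` lies above a parabola whose leading coefficient exceeds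
`s / 2`. -/
lemma exists_quadratic_le_rpow_neg {s : ℝ} (hs : 0 < s) :
    ∃ τ : ℝ, 0 < τ ∧ τ ≤ 1 / 2 ∧ ∀ t : ℝ, |t - 1| ≤ τ →
      1 - s * (t - 1) + (s / 2 + s ^ 2 / 4) * (t - 1) ^ 2 ≤ t ^ (-s) := by
  -- The Taylor coefficient of t^(-s) at 1 is s/2 + s²/2. Giving up s²/4 leaves h''(1) = s²/2 > 0,
  -- so h has a local minimum at 1.
  set α := s / 2 + s ^ 2 / 4 with hα
  let h : ℝ → ℝ := fun t => t ^ (-s) + s * (t - 1) - α * (t - 1) ^ 2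
  have hd : ∀ t : ℝ, 0 < t →
      HasDerivAt h (-s * t ^ (-s - 1) + s - 2 * α * (t - 1)) t := by
    intro t ht
    have h1 := Real.hasDerivAt_rpow_const (x := t) (p := -s) (Or.inl ht.ne')
    have h2 := (((hasDerivAt_id t).sub_const 1).const_mul s)
    have h3 := ((((hasDerivAt_id t).sub_const 1).pow 2).const_mul α)
    refine ((h1.add h2).sub h3).congr_deriv ?_
    simp only [id_eq]
    push_cast
    ring
  have hderiv : deriv h =ᶠ[𝓝 1] fun t => -s * t ^ (-s - 1) + s - 2 * α * (t - 1) := by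
    filter_upwards [lt_mem_nhds (zero_lt_one (α := ℝ))] with t ht using (hd t ht).deriv
  have hdd : deriv (deriv h) 1 = s ^ 2 / 2 := by
    rw [hderiv.deriv_eq]
    have h1 := (Real.hasDerivAt_rpow_const (x := (1 : ℝ)) (p := -s - 1)
      (Or.inl one_ne_zero)).const_mul (-s)
    have h2 := ((hasDerivAt_id (1 : ℝ)).sub_const 1).const_mul (2 * α)
    have := ((h1.add_const s).sub h2).deriv
    simp only [Real.one_rpow] at this
    refine Eq.trans ?_ (this.trans ?_)
    · rfl
    · rw [hα]; ring
  have hmin : IsLocalMin h 1 := isLocalMin_of_deriv_deriv_pos (by rw [hdd]; positivity)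
    (by rw [hderiv.eq_of_nhds]; simp) (hd 1 one_pos).continuousAt
  obtain ⟨ε, hε, hball⟩ := Metric.eventually_nhds_iff.1 hmin
  refine ⟨min (ε / 2) (1 / 2), by positivity, min_le_right _ _, fun t ht => ?_⟩
  have := hball (y := t) (by
    rw [Real.dist_eq]
    have := ht.trans (min_le_left _ _)
    linarith)
  simp only [h, sub_self, Real.one_rpow] at this
  linarith

lemma ofReal_integral_le_lintegral {α : Type*} [MeasurableSpace α] {m : Measure α} {f : α → ℝ}
    (hf : Integrable f m) : ENNReal.ofReal (∫ x, f x ∂m) ≤ ∫⁻ x, ENNReal.ofReal (f x) ∂m := by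
  calc ENNReal.ofReal (∫ x, f x ∂m) ≤ ENNReal.ofReal (∫ x, max (f x) 0 ∂m) :=
        ENNReal.ofReal_le_ofReal (integral_mono hf hf.pos_part fun x => le_max_left _ _)
    _ = ∫⁻ x, ENNReal.ofReal (max (f x) 0) ∂m :=
        ofReal_integral_eq_lintegral_ofReal hf.pos_part (ae_of_all _ fun x => le_max_right _ _)
    _ = _ := by simp

section Recurrence

variable {E : Type*} [NormedAddCommGroup E] [InnerProductSpace ℝ E] [FiniteDimensional ℝ E]
  [MeasurableSpace E] [BorelSpace E] {μ : Measure E} [μ.IsAddHaarMeasure] {K : Set E}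

namespace IsSymmBody

variable (hK : IsSymmBody K)
include hK

lemma integrable_unif {g : E → ℝ} (hg : Continuous g) : Integrable g (unif μ K) :=
  (hg.continuousOn.integrableOn_compact hK.compact).smul_measure
    (ENNReal.inv_ne_top.2 hK.measure_ne_zero)

lemma ae_mem_unif : ∀ᵐ y ∂unif μ K, y ∈ K :=
  Measure.smul_absolutelyContinuous.ae_le (ae_restrict_mem hK.compact.measurableSet)

lemma integral_unif_odd {g : E → ℝ} (hg : ∀ y, g (-y) = -g y) : ∫ y, g y ∂unif μ K = 0 := by
  have hpre : Neg.neg ⁻¹' K = K := by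
    ext y
    exact ⟨fun h => by simpa using hK.symm _ h, fun h => hK.symm _ h⟩
  have hmp := (Measure.measurePreserving_neg μ).restrict_preimage hK.compact.measurableSet
  rw [hpre] at hmp
  have h1 := hmp.integral_comp (MeasurableEquiv.neg E).measurableEmbedding g
  have h2 : ∫ y in K, g y ∂μ = 0 := by
    simp only [hg, integral_neg] at h1
    linarith
  rw [unif, integral_smul_measure, h2, smul_zero]

/-- If the integral vanished, the open subset of the interior of K where the linear form is nonzero
would be null, hence empty; but it contains a small multiple of u. -/
lemma integral_inner_sq_pos {u : E} (hu : u ≠ 0) : 0 < ∫ y, ⟪u, y⟫ * ⟪u, y⟫ ∂unif μ K := by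
  have hnn : ∀ y : E, 0 ≤ ⟪u, y⟫ * ⟪u, y⟫ := fun y => mul_self_nonneg _
  refine lt_of_le_of_ne (integral_nonneg hnn) fun h0 => ?_
  have h1 := (integral_eq_zero_iff_of_nonneg hnn (hK.integrable_unif (by fun_prop))).1 h0.symm
  have h2 : ∀ᵐ y ∂μ.restrict K, ⟪u, y⟫ * ⟪u, y⟫ = 0 :=
    (Measure.absolutelyContinuous_smul
      (ENNReal.inv_ne_zero.2 hK.measure_ne_top)).ae_le h1
  rw [ae_restrict_iff' hK.compact.measurableSet] at h2
  have hopen : IsOpen (interior K ∩ {y : E | ⟪u, y⟫ ≠ 0}) :=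
    isOpen_interior.inter (isOpen_ne_fun (by fun_prop) (by fun_prop))
  have hempty : interior K ∩ {y : E | ⟪u, y⟫ ≠ 0} = ∅ := by
    refine hopen.measure_eq_zero_iff μ |>.1 (measure_mono_null ?_ h2)
    intro y hy h
    exact hy.2 (mul_self_eq_zero.1 (h (interior_subset hy.1)))
  have hlim : Tendsto (fun ε : ℝ => ε • u) (𝓝[>] 0) (𝓝 0) := by
    refine Tendsto.mono_left ?_ nhdsWithin_le_nhds
    exact Continuous.tendsto' (by fun_prop) 0 0 (zero_smul ℝ u)
  obtain ⟨ε, hε, hε0⟩ := ((hlim.eventually (interior_mem_nhds.2 hK.mem_nhds)).and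
    self_mem_nhdsWithin).exists
  have : ε • u ∈ interior K ∩ {y : E | ⟪u, y⟫ ≠ 0} := by
    refine ⟨hε, ?_⟩
    have hε0 : 0 < ε := hε0
    simp [inner_smul_right, hε0.ne', hu]
  rw [hempty] at this
  exact this

/-- A linear change of coordinates that puts the uniform measure on `K` in isotropic position. -/
lemma exists_isotropic : ∃ L : E →L[ℝ] EuclideanSpace ℝ (Fin (finrank ℝ E)),
    (∀ x, L x = 0 → x = 0) ∧ (∀ u, ∫ y, ⟪u, L y⟫ ^ 2 ∂unif μ K = ‖u‖ ^ 2) ∧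
      ∫ y, ‖L y‖ ^ 2 ∂unif μ K = finrank ℝ E := by
  have hInt : ∀ u v : E, Integrable (fun y => ⟪u, y⟫ * ⟪v, y⟫) (unif μ K) :=
    fun u v => hK.integrable_unif (by fun_prop)
  let B : LinearMap.BilinForm ℝ E := LinearMap.mk₂ ℝ
    (fun u v => ∫ y, ⟪u, y⟫ * ⟪v, y⟫ ∂unif μ K)
    (fun u u' v => by
      simp only [inner_add_left, add_mul]
      exact integral_add (hInt _ _) (hInt _ _))
    (fun c u v => by
      simp only [real_inner_smul_left, mul_assoc, integral_const_mul, smul_eq_mul])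
    (fun u v v' => by
      simp only [inner_add_left, mul_add]
      exact integral_add (hInt _ _) (hInt _ _))
    (fun c u v => by
      simp only [real_inner_smul_left, mul_left_comm, integral_const_mul, smul_eq_mul])
  have hB : ∀ u v, B u v = ∫ y, ⟪u, y⟫ * ⟪v, y⟫ ∂unif μ K := fun u v => rfl
  have hsymm : LinearMap.IsSymm B := ⟨fun u v => by simp only [hB, RingHom.id_apply, mul_comm]⟩
  -- B is the covariance form of K. Dividing each functional of a B-orthogonal basis by its standard
  -- deviation gives coordinates with identity covariance.
  obtain ⟨v, hv⟩ := LinearMap.BilinForm.exists_orthogonal_basis (B := B) hsymm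
  have hw : ∀ i, 0 < B (v i) (v i) := fun i => hK.integral_inner_sq_pos (v.ne_zero i)
  let ℓ : Fin (finrank ℝ E) → E →L[ℝ] ℝ := fun i => (√(B (v i) (v i)))⁻¹ • innerSL ℝ (v i)
  have hℓ : ∀ i y, ℓ i y = (√(B (v i) (v i)))⁻¹ * ⟪v i, y⟫ := fun i y => rfl
  have hδ : ∀ i j, ∫ y, ℓ i y * ℓ j y ∂unif μ K = if i = j then 1 else 0 := by
    intro i j
    have : ∀ y, ℓ i y * ℓ j y = ((√(B (v i) (v i)))⁻¹ * (√(B (v j) (v j)))⁻¹) *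
        (⟪v i, y⟫ * ⟪v j, y⟫) := fun y => by rw [hℓ, hℓ]; ring
    simp only [this, integral_const_mul, ← hB]
    split_ifs with h
    · subst h
      rw [← mul_inv, Real.mul_self_sqrt (hw i).le, inv_mul_cancel₀ (hw i).ne']
    · rw [show B (v i) (v j) = 0 from hv h, mul_zero]
  let L : E →L[ℝ] EuclideanSpace ℝ (Fin (finrank ℝ E)) :=
    (EuclideanSpace.equiv (Fin (finrank ℝ E)) ℝ).symm.toContinuousLinearMap.comp
      (ContinuousLinearMap.pi ℓ)
  have hL : ∀ y i, L y i = ℓ i y := fun y i => rfl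
  refine ⟨L, fun x hx => ?_, fun u => ?_, ?_⟩
  · refine InnerProductSpace.ext_inner_left_basis (𝕜 := ℝ) v fun i => ?_
    have h1 : ℓ i x = 0 := by rw [← hL, hx]; rfl
    rw [hℓ] at h1
    rw [inner_zero_right]
    exact (mul_eq_zero.1 h1).resolve_left (inv_ne_zero (Real.sqrt_pos.2 (hw i)).ne')
  · have : ∀ y, ⟪u, L y⟫ ^ 2 = ∑ i, ∑ j, (u i * u j) * (ℓ i y * ℓ j y) := by
      intro y
      rw [sq, PiLp.inner_apply, Finset.sum_mul_sum]
      refine Finset.sum_congr rfl fun i _ => Finset.sum_congr rfl fun j _ => ?_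
      simp only [hL, RCLike.inner_apply, conj_trivial]
      ring
    simp only [this]
    rw [integral_finsetSum _ fun i _ => hK.integrable_unif (by fun_prop)]
    have h2 : ∀ i, ∫ y, ∑ j, (u i * u j) * (ℓ i y * ℓ j y) ∂unif μ K = u i ^ 2 := by
      intro i
      rw [integral_finsetSum _ fun j _ => hK.integrable_unif (by fun_prop)]
      simp only [integral_const_mul, hδ]
      simp [sq]
    simp only [h2, EuclideanSpace.norm_sq_eq, Real.norm_eq_abs, sq_abs]
  · have : ∀ y, ‖L y‖ ^ 2 = ∑ i, ℓ i y * ℓ i y := by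
      intro y
      rw [EuclideanSpace.norm_sq_eq]
      simp only [Real.norm_eq_abs, sq_abs, hL, ← sq]
    simp only [this]
    rw [integral_finsetSum _ fun i _ => hK.integrable_unif (by fun_prop)]
    simp [hδ]

end IsSymmBody
end Recurrence

/-! ### Recurrence in dimension at most two. -/

section Recurrence

variable {E : Type*} [NormedAddCommGroup E] [InnerProductSpace ℝ E] [FiniteDimensional ℝ E]
  [MeasurableSpace E] [BorelSpace E] {μ : Measure E} [μ.IsAddHaarMeasure] {K : Set E}

namespace IsSymmBody

variable (hK : IsSymmBody K)
include hK

lemma exists_norm_le {F : Type*} [NormedAddCommGroup F] [NormedSpace ℝ F] (L : E →L[ℝ] F) :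
    ∃ b : ℝ, 1 ≤ b ∧ ∀ y ∈ K, ‖L y‖ ≤ b := by
  obtain ⟨b, hb⟩ := hK.compact.exists_bound_of_continuousOn L.continuous.continuousOn
  exact ⟨max b 1, le_max_right _ _, fun y hy => (hb y hy).trans (le_max_left _ _)⟩

/-- In dimension at most two, a small negative power of the isotropic norm is strictly
subharmonic for averages over `K`, uniformly at the scale of the distance to the origin. -/
lemma exists_subharmonic (hd : finrank ℝ E ≤ 2)
    {L : E →L[ℝ] EuclideanSpace ℝ (Fin (finrank ℝ E))}
    (hL₂ : ∀ u, ∫ y, ⟪u, L y⟫ ^ 2 ∂unif μ K = ‖u‖ ^ 2)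
    (hL₃ : ∫ y, ‖L y‖ ^ 2 ∂unif μ K = finrank ℝ E) {s : ℝ} (hs : 0 < s) :
    ∃ c κ : ℝ, 0 < c ∧ 0 < κ ∧ ∀ x, L x ≠ 0 →
      (∀ y ∈ K, ‖L x‖ ^ 2 / 2 ≤ ‖L (x + (c * ‖L x‖) • y)‖ ^ 2) ∧
      ∃ P : E → ℝ, Integrable P (unif μ K) ∧ 1 + κ ≤ ∫ y, P y ∂unif μ K ∧
        ∀ y ∈ K, P y * (‖L x‖ ^ 2) ^ (-s) ≤ (‖L (x + (c * ‖L x‖) • y)‖ ^ 2) ^ (-s) := by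
  have := hK.isProbabilityMeasure_unif (μ := μ)
  obtain ⟨τ, hτ0, hτ2, hτ⟩ := exists_quadratic_le_rpow_neg hs
  obtain ⟨b, hb1, hb⟩ := hK.exists_norm_le L
  have hb0 : 0 < b := by linarith
  -- For y in K the ratio of squared norms then differs from 1 by at most 2cb + (cb)² ≤ 3cb = τ.
  set c := τ / (3 * b) with hc
  have hc0 : 0 < c := by positivity
  have hcb : 3 * (c * b) = τ := by rw [hc]; field_simp
  refine ⟨c, s ^ 2 * c ^ 2, hc0, by positivity, fun x hx => ?_⟩
  have hN : 0 < ‖L x‖ := norm_pos_iff.2 hx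
  set N := ‖L x‖ with hNdef
  set e := N⁻¹ • L x with he
  have hnorm_e : ‖e‖ = 1 := by
    rw [he, norm_smul, Real.norm_of_nonneg (by positivity), ← hNdef, inv_mul_cancel₀ hN.ne']
  have hexp : ∀ y, ‖L (x + (c * N) • y)‖ ^ 2
      = N ^ 2 * (1 + (2 * c * ⟪e, L y⟫ + c ^ 2 * ‖L y‖ ^ 2)) := by
    intro y
    rw [map_add, map_smul, norm_add_sq_real, norm_smul, inner_smul_right, he,
      real_inner_smul_left, Real.norm_of_nonneg (by positivity), ← hNdef]
    field_simp
    ring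
  have hsmall : ∀ y ∈ K, |2 * c * ⟪e, L y⟫ + c ^ 2 * ‖L y‖ ^ 2| ≤ τ := by
    intro y hy
    have h1 : |⟪e, L y⟫| ≤ b := by
      refine (abs_real_inner_le_norm _ _).trans ?_
      rw [hnorm_e, one_mul]; exact hb y hy
    have h2 : ‖L y‖ ^ 2 ≤ b ^ 2 := by gcongr; exact hb y hy
    have h3 : c * b ≤ 1 := by linarith
    calc |2 * c * ⟪e, L y⟫ + c ^ 2 * ‖L y‖ ^ 2|
        ≤ |2 * c * ⟪e, L y⟫| + |c ^ 2 * ‖L y‖ ^ 2| := abs_add_le _ _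
      _ = 2 * c * |⟪e, L y⟫| + c ^ 2 * ‖L y‖ ^ 2 := by
          rw [abs_mul, abs_of_pos (by positivity : 0 < 2 * c),
            abs_of_nonneg (by positivity : 0 ≤ c ^ 2 * ‖L y‖ ^ 2)]
      _ ≤ 2 * c * b + c ^ 2 * b ^ 2 := by gcongr
      _ ≤ 3 * (c * b) := by nlinarith [mul_pos hc0 hb0]
      _ = τ := hcb
  refine ⟨fun y hy => ?_, ?_⟩
  · rw [hexp]
    have := (abs_le.1 (hsmall y hy)).1
    nlinarith [sq_nonneg N]
  · set α := s / 2 + s ^ 2 / 4 with hα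
    have hα0 : 0 < α := by positivity
    have i1 : Integrable (fun y => ⟪e, L y⟫) (unif μ K) := hK.integrable_unif (by fun_prop)
    have i2 : Integrable (fun y => ‖L y‖ ^ 2) (unif μ K) := hK.integrable_unif (by fun_prop)
    have i3 : Integrable (fun y => ⟪e, L y⟫ ^ 2) (unif μ K) := hK.integrable_unif (by fun_prop)
    have i4 : Integrable (fun y => ⟪e, L y⟫ * ‖L y‖ ^ 2) (unif μ K) :=
      hK.integrable_unif (by fun_prop)
    have e1 : ∫ y, ⟪e, L y⟫ ∂unif μ K = 0 := hK.integral_unif_odd fun y => by simp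
    have e4 : ∫ y, ⟪e, L y⟫ * ‖L y‖ ^ 2 ∂unif μ K = 0 := hK.integral_unif_odd fun y => by simp
    -- P is the parabola evaluated at the ratio of squared norms, without its nonnegative term α c⁴
    -- ‖L y‖⁴. The odd terms integrate to zero, and the rest gives 1 + c² (2s + s² - s d) ≥ 1 + s²
    -- c² because d ≤ 2.
    refine ⟨fun y => ((1 - (2 * s * c) * ⟪e, L y⟫) - (s * c ^ 2) * ‖L y‖ ^ 2) +
      (4 * α * c ^ 2) * ⟪e, L y⟫ ^ 2 + (4 * α * c ^ 3) * (⟪e, L y⟫ * ‖L y‖ ^ 2), ?_, ?_, ?_⟩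
    · exact hK.integrable_unif (by fun_prop)
    · rw [integral_add (hK.integrable_unif (by fun_prop)) (i4.const_mul _),
        integral_add (hK.integrable_unif (by fun_prop)) (i3.const_mul _),
        integral_sub (hK.integrable_unif (by fun_prop)) (i2.const_mul _),
        integral_sub (integrable_const _) (i1.const_mul _)]
      simp only [integral_const_mul, e1, e4, hL₂, hL₃, hnorm_e, integral_const, probReal_univ,
        one_smul]
      have hd' : (finrank ℝ E : ℝ) ≤ 2 := by exact_mod_cast hd
      have h1 : s * c ^ 2 * (finrank ℝ E : ℝ) ≤ s * c ^ 2 * 2 := by gcongr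
      rw [hα]
      nlinarith
    · intro y hy
      have h1 := hτ (1 + (2 * c * ⟪e, L y⟫ + c ^ 2 * ‖L y‖ ^ 2)) (by
        rw [add_sub_cancel_left]; exact hsmall y hy)
      have h2 := (abs_le.1 (hsmall y hy)).1
      rw [hexp, Real.mul_rpow (by positivity) (by linarith), mul_comm]
      refine mul_le_mul_of_nonneg_left (le_trans ?_ h1) (by positivity)
      have h3 : 0 ≤ α * (c ^ 2 * ‖L y‖ ^ 2) ^ 2 := by positivity
      nlinarith

/-- Small dilates about a point of D stay inside D, so the bound reproduces itself. -/
lemma one_le_iterate_of_isOpen {D : Set E} (hD : IsOpen D) {f : E → ℝ≥0∞}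
    (hf : ∀ x ∈ D, 1 ≤ f x) (k : ℕ) : ∀ x ∈ D, 1 ≤ (maxAvg (unif μ K))^[k] f x := by
  have := hK.isProbabilityMeasure_unif (μ := μ)
  induction k with
  | zero => exact hf
  | succ k ih =>
    intro x hx
    rw [Function.iterate_succ_apply']
    obtain ⟨b, hb1, hb⟩ := hK.exists_norm_le (ContinuousLinearMap.id ℝ E)
    obtain ⟨ε, hε, hball⟩ := Metric.isOpen_iff.1 hD x hx
    have hr : 0 < ε / (2 * b) := by positivity
    refine le_trans ?_ (le_maxAvg _ _ x hr)
    calc (1 : ℝ≥0∞) = ∫⁻ _, 1 ∂unif μ K := by simp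
      _ ≤ _ := by
        refine lintegral_mono_ae ?_
        filter_upwards [hK.ae_mem_unif (μ := μ)] with y hy
        refine ih _ (hball ?_)
        rw [mem_ball, dist_self_add_left, norm_smul, Real.norm_of_nonneg hr.le]
        calc ε / (2 * b) * ‖y‖ ≤ ε / (2 * b) * b := by gcongr; exact hb y hy
          _ = ε / 2 := by field_simp
          _ < ε := by linarith

/-- Recurrence: in dimension at most two, iterating the maximal operator on the indicator of `K`
brings it as close to `1` as desired on `3 • K`. -/
lemma exists_iterate_indicator_ge (hd : finrank ℝ E ≤ 2) {η : ℝ} (hη : 0 < η) :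
    ∃ k : ℕ, ∀ x ∈ (3 : ℝ) • K,
      ENNReal.ofReal (1 - η) ≤ (maxAvg (unif μ K))^[k] (K.indicator 1) x := by
  have := hK.isProbabilityMeasure_unif (μ := μ)
  obtain ⟨L, hL₁, hL₂, hL₃⟩ := hK.exists_isotropic (μ := μ)
  obtain ⟨b, hb1, hb⟩ := hK.exists_norm_le L
  obtain ⟨ρ, hρ, hρK⟩ : ∃ ρ : ℝ, 0 < ρ ∧ ∀ x, ‖L x‖ ^ 2 < ρ → x ∈ K := by
    obtain ⟨ε, hε, hball⟩ := Metric.mem_nhds_iff.1 hK.mem_nhds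
    have hker : LinearMap.ker (L : E →ₗ[ℝ] EuclideanSpace ℝ (Fin (finrank ℝ E))) = ⊥ :=
      LinearMap.ker_eq_bot'.2 fun x hx => hL₁ x hx
    obtain ⟨C, hC, hLC⟩ := L.toLinearMap.exists_antilipschitzWith hker
    refine ⟨(ε / C) ^ 2, by positivity, fun x hx => hball ?_⟩
    have h1 : ‖L x‖ < ε / C := lt_of_pow_lt_pow_left₀ 2 (by positivity) hx
    have h2 : dist x 0 ≤ C * dist (L x) (L 0) := hLC.le_mul_dist x 0
    rw [map_zero, dist_zero_right (L x)] at h2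
    rw [mem_ball]
    calc dist x 0 ≤ C * ‖L x‖ := h2
      _ < C * (ε / C) := by gcongr
      _ = ε := by field_simp
  -- A step from a point with `‖L x‖ ^ 2 ≥ ρ` at most halves the squared norm, so it lands where the
  -- induction hypothesis holds.
  set ρ₀ := ρ / 2 with hρ₀
  have hρ₀0 : 0 < ρ₀ := by positivity
  -- On 3K the squared norm is at most 9b², so a small s makes φ at least 1 - η/2 there (outside the
  -- sublevel set).
  obtain ⟨s, hs, hsη⟩ : ∃ s : ℝ, 0 < s ∧ 1 - η / 2 ≤ (9 * b ^ 2 / ρ₀) ^ (-s) := by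
    have hlim : Tendsto (fun s : ℝ => (9 * b ^ 2 / ρ₀) ^ (-s)) (𝓝[>] 0) (𝓝 1) := by
      refine Tendsto.mono_left ?_ nhdsWithin_le_nhds
      have : Continuous fun s : ℝ => (9 * b ^ 2 / ρ₀) ^ (-s) :=
        Continuous.rpow continuous_const continuous_neg fun _ => Or.inl (by positivity)
      exact this.tendsto' 0 1 (by simp)
    obtain ⟨s, h1, h2⟩ := ((hlim.eventually (lt_mem_nhds
      (by linarith : 1 - η / 2 < 1))).and self_mem_nhdsWithin).exists
    exact ⟨s, h2, h1.le⟩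
  obtain ⟨c, κ, hc, hκ0, hsub⟩ := hK.exists_subharmonic hd hL₂ hL₃ hs
  let φ : E → ℝ := fun x => (‖L x‖ ^ 2 / ρ₀) ^ (-s)
  have hD : IsOpen {x : E | ‖L x‖ ^ 2 < ρ} := isOpen_lt (by fun_prop) continuous_const
  have honD : ∀ k, ∀ x ∈ {x : E | ‖L x‖ ^ 2 < ρ},
      1 ≤ (maxAvg (unif μ K))^[k] (K.indicator 1) x :=
    hK.one_le_iterate_of_isOpen hD fun x hx => by rw [indicator_of_mem (hρK x hx)]; rfl
  have hφ1 : ∀ x, ρ₀ ≤ ‖L x‖ ^ 2 → φ x ≤ 1 := fun x hx =>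
    Real.rpow_le_one_of_one_le_of_nonpos ((one_le_div hρ₀0).2 hx) (by linarith)
  -- At k = 0 the bound is trivial since φ ≤ 1; the strict gain 1 + κ then shrinks the error
  -- geometrically.
  have key : ∀ (k : ℕ) (x : E), ρ₀ ≤ ‖L x‖ ^ 2 →
      ENNReal.ofReal (φ x - (1 + κ)⁻¹ ^ k) ≤ (maxAvg (unif μ K))^[k] (K.indicator 1) x := by
    intro k
    induction k with
    | zero =>
      intro x hx
      rw [ENNReal.ofReal_of_nonpos (by simpa using hφ1 x hx)]
      exact zero_le
    | succ k ih =>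
      intro x hx
      rcases lt_or_ge (‖L x‖ ^ 2) ρ with hxρ | hxρ
      · refine le_trans ?_ (honD (k + 1) x hxρ)
        refine ENNReal.ofReal_le_one.2 ?_
        have := hφ1 x hx
        have : 0 ≤ (1 + κ)⁻¹ ^ (k + 1) := by positivity
        linarith
      have hLx : L x ≠ 0 := by
        intro h
        rw [h] at hxρ
        simp at hxρ
        linarith
      have hN : 0 < ‖L x‖ := norm_pos_iff.2 hLx
      obtain ⟨hhalf, P, hPi, hPint, hP⟩ := hsub x hLx
      have ha : 0 ≤ (1 + κ)⁻¹ ^ k := by positivity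
      set a := (1 + κ)⁻¹ ^ k with ha_def
      rcases le_total (φ x) ((1 + κ)⁻¹ ^ (k + 1)) with hφa | hφa
      · rw [ENNReal.ofReal_of_nonpos (by linarith)]; exact zero_le
      rw [Function.iterate_succ_apply']
      refine le_trans ?_ (le_maxAvg _ _ x (mul_pos hc hN))
      have hstep : ENNReal.ofReal (∫ y, (P y * φ x - a) ∂unif μ K) ≤
          ∫⁻ y, (maxAvg (unif μ K))^[k] (K.indicator 1) (x + (c * ‖L x‖) • y) ∂unif μ K := by
        refine (ofReal_integral_le_lintegral ((hPi.mul_const _).sub (integrable_const _))).trans ?_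
        refine lintegral_mono_ae ?_
        filter_upwards [hK.ae_mem_unif (μ := μ)] with y hy
        have h1 := hhalf y hy
        refine le_trans (ENNReal.ofReal_le_ofReal ?_) (ih (x + (c * ‖L x‖) • y) (by linarith))
        have h2 := hP y hy
        refine sub_le_sub_right ?_ _
        simp only [φ]
        rw [Real.div_rpow (by positivity) hρ₀0.le, Real.div_rpow (by positivity) hρ₀0.le,
          ← mul_div_assoc]
        exact div_le_div_of_nonneg_right h2 (by positivity)
      refine le_trans (ENNReal.ofReal_le_ofReal ?_) hstep
      rw [integral_sub (hPi.mul_const _) (integrable_const _), integral_mul_const]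
      simp only [integral_const, probReal_univ, one_smul]
      have hφ0 : 0 ≤ φ x := by positivity
      have : (1 + κ) * φ x ≤ (∫ y, P y ∂unif μ K) * φ x := by gcongr
      have ha' : (1 + κ) * (1 + κ)⁻¹ ^ (k + 1) = a := by
        rw [pow_succ, ← ha_def]
        field_simp
      -- The surplus is at least κ (φ x - (1 + κ)^(-(k+1))), which is nonnegative in the present
      -- case.
      nlinarith
  obtain ⟨k, hk⟩ := exists_pow_lt_of_lt_one (half_pos hη) (inv_lt_one_of_one_lt₀ (by linarith : 1 < 1 + κ))
  refine ⟨k, fun x hx => ?_⟩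
  rcases lt_or_ge (‖L x‖ ^ 2) ρ with hxρ | hxρ
  · refine le_trans (ENNReal.ofReal_le_one.2 (by linarith)) (honD k x hxρ)
  refine le_trans (ENNReal.ofReal_le_ofReal ?_) (key k x (by linarith))
  obtain ⟨y, hy, rfl⟩ := hx
  have h1 : ‖L ((3 : ℝ) • y)‖ ^ 2 ≤ 9 * b ^ 2 := by
    rw [map_smul, norm_smul, mul_pow]
    have := hb y hy
    have : ‖L y‖ ^ 2 ≤ b ^ 2 := by gcongr
    norm_num
    linarith
  have h2 : (9 * b ^ 2 / ρ₀) ^ (-s) ≤ φ ((3 : ℝ) • y) := by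
    refine Real.rpow_le_rpow_of_nonpos ?_ (by gcongr) (by linarith)
    have : 0 < ‖L ((3 : ℝ) • y)‖ ^ 2 := by linarith
    positivity
  linarith

end IsSymmBody
end Recurrence

/-! ### Growth of superlevel sets and doubling of the norm under iteration. -/

section Growth

variable {E : Type*} [NormedAddCommGroup E] [InnerProductSpace ℝ E] [FiniteDimensional ℝ E]
  [MeasurableSpace E] [BorelSpace E] {μ : Measure E} [μ.IsAddHaarMeasure] {K : Set E}

lemma lintegral_unif_indicator {S : Set E} (hS : MeasurableSet S) (x : E) {r : ℝ} (hr : 0 < r) :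
    ∫⁻ y, S.indicator 1 (x + r • y) ∂unif μ K = μ (S ∩ (x +ᵥ r • K)) / μ (x +ᵥ r • K) := by
  rw [lintegral_unif _ _ hr, ENNReal.div_eq_inv_mul, lintegral_indicator_one hS,
    Measure.restrict_apply hS]

namespace IsSymmBody

variable (hK : IsSymmBody K)
include hK

lemma ae_le_iterate {f : E → ℝ≥0∞} (hf : Measurable f) (n : ℕ) :
    f ≤ᵐ[μ] (maxAvg (unif μ K))^[n] f := by
  induction n with
  | zero => exact ae_of_all _ fun _ => le_rfl
  | succ n ih =>
    rw [Function.iterate_succ_apply']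
    filter_upwards [hK.ae_le_maxAvg (μ := μ) hf] with x hx
    exact hx.trans (maxAvg_mono_ae ih x)

/-- For x in K the dilate x + 2K contains K and has 2^d times its volume. -/
lemma lintegral_unif_two_ge {S : Set E} (hS : MeasurableSet S) {x : E} (hx : x ∈ K) :
    (∫⁻ y, S.indicator 1 y ∂unif μ K) / ENNReal.ofReal (2 ^ finrank ℝ E) ≤
      ∫⁻ y, S.indicator 1 (x + (2 : ℝ) • y) ∂unif μ K := by
  have h1 := lintegral_unif_indicator (μ := μ) (K := K) hS 0 one_pos
  simp only [zero_add, one_smul, zero_vadd] at h1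
  have hsub : K ⊆ x +ᵥ (2 : ℝ) • K := by
    have := hK.dilate_subset (x := x) (z := 0) (ρ := 1) (r := 1) (s := 2) zero_le_one zero_le_one
      (by norm_num) (hK.mem_dilate_comm (mem_dilate.2 ⟨x, hx, by simp⟩))
    simpa using this
  rw [h1, lintegral_unif_indicator hS x two_pos, measure_dilate x two_pos.le, div_eq_mul_inv,
    div_eq_mul_inv, div_eq_mul_inv, mul_assoc,
    ENNReal.mul_inv (Or.inl (by simp)) (Or.inl ENNReal.ofReal_ne_top), mul_comm (μ K)⁻¹]
  gcongr

/-- If a set has density at least `θ` in `K`, a number of iterations depending only on `θ` and `K`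
brings the maximal function of its indicator above `1 / 2` on `K`. -/
lemma exists_iterate_ge_half (hd : finrank ℝ E ≤ 2) {θ : ℝ} (hθ : 0 < θ) (hθ1 : θ ≤ 1) :
    ∃ k : ℕ, ∀ S : Set E, MeasurableSet S →
      ENNReal.ofReal θ ≤ ∫⁻ y, S.indicator 1 y ∂unif μ K →
      ∀ x ∈ K, ENNReal.ofReal (1 / 2) ≤ (maxAvg (unif μ K))^[k] (S.indicator 1) x := by
  have := hK.isProbabilityMeasure_unif (μ := μ)
  set c := θ / 2 ^ finrank ℝ E with hc
  have hc0 : 0 < c := by positivity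
  have hc1 : c ≤ 1 := (div_le_one (by positivity)).2 (hθ1.trans (one_le_pow₀ one_le_two))
  obtain ⟨j, hj⟩ := hK.exists_iterate_indicator_ge (μ := μ) hd (half_pos hc0)
  -- Recurrence spreads the bound m on K to w = m (1 - c/2) on 3K, while on S the iterates are
  -- almost everywhere at least 1. As S fills a fraction at least c of x + 2K ⊆ 3K, one more average
  -- gives w + (1 - w) c ≥ m + c/4 when m ≤ 1/2.
  have step : ∀ S : Set E, MeasurableSet S →
      ENNReal.ofReal θ ≤ ∫⁻ y, S.indicator 1 y ∂unif μ K → ∀ (n : ℕ) (m : ℝ), 0 ≤ m → m ≤ 1 / 2 →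
      (∀ x ∈ K, ENNReal.ofReal m ≤ (maxAvg (unif μ K))^[n] (S.indicator 1) x) →
      ∀ x ∈ K, ENNReal.ofReal (m + c / 4) ≤
        (maxAvg (unif μ K))^[j + n + 1] (S.indicator 1) x := by
    intro S hS hSθ n m hm0 hm hn x hx
    set w := m * (1 - c / 2) with hw
    have hw0 : 0 ≤ w := mul_nonneg hm0 (by linarith)
    have hw1 : w ≤ 1 := by nlinarith
    have h3 : ∀ z ∈ (3 : ℝ) • K,
        ENNReal.ofReal w ≤ (maxAvg (unif μ K))^[j + n] (S.indicator 1) z := by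
      intro z hz
      have hle : (fun y => ENNReal.ofReal m * K.indicator 1 y) ≤
          (maxAvg (unif μ K))^[n] (S.indicator 1) := by
        intro y
        by_cases hy : y ∈ K
        · simpa [hy] using hn y hy
        · simp [hy]
      have h := (maxAvg_mono (unif μ K)).iterate j hle z
      rw [maxAvg_iterate_const_mul _ ENNReal.ofReal_ne_top, ← Function.iterate_add_apply] at h
      refine le_trans ?_ h
      rw [hw, ENNReal.ofReal_mul hm0]
      exact mul_le_mul_right (hj z hz) _
    rw [Function.iterate_succ_apply']
    refine le_trans ?_ (le_maxAvg _ _ x two_pos)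
    let h : E → ℝ≥0∞ := fun z => ENNReal.ofReal w + ENNReal.ofReal (1 - w) * S.indicator 1 z
    have hae : ((3 : ℝ) • K).indicator h ≤ᵐ[μ] (maxAvg (unif μ K))^[j + n] (S.indicator 1) := by
      filter_upwards [hK.ae_le_iterate (μ := μ) (measurable_one.indicator hS) (j + n)] with z hz
      by_cases hz3 : z ∈ (3 : ℝ) • K
      · rw [indicator_of_mem hz3]
        by_cases hzS : z ∈ S
        · simp only [h, indicator_of_mem hzS, Pi.one_apply, mul_one] at hz ⊢
          rwa [← ENNReal.ofReal_add hw0 (by linarith), add_sub_cancel, ENNReal.ofReal_one]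
        · simp only [h, indicator_of_notMem hzS, mul_zero, add_zero]
          exact h3 z hz3
      · rw [indicator_of_notMem hz3]; exact zero_le
    refine le_trans ?_ (lintegral_unif_mono_ae hae x two_pos)
    have hmem : ∀ y ∈ K, x + (2 : ℝ) • y ∈ (3 : ℝ) • K := by
      intro y hy
      have := hK.dilate_subset (x := 0) (z := x) (ρ := 1) (r := 2) (s := 3) zero_le_one
        zero_le_two (by norm_num) (mem_dilate.2 ⟨x, hx, by simp⟩) (mem_dilate.2 ⟨y, hy, rfl⟩)
      simpa using this
    calc ENNReal.ofReal (m + c / 4) ≤ ENNReal.ofReal (w + (1 - w) * c) := by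
          refine ENNReal.ofReal_le_ofReal ?_
          rw [hw]
          nlinarith [mul_nonneg hm0 hc0.le, mul_nonneg (mul_nonneg hm0 hc0.le) hc0.le]
      _ = ENNReal.ofReal w + ENNReal.ofReal (1 - w) * ENNReal.ofReal c := by
          rw [ENNReal.ofReal_add hw0 (mul_nonneg (by linarith) hc0.le),
            ENNReal.ofReal_mul (by linarith : 0 ≤ 1 - w)]
      _ ≤ ENNReal.ofReal w + ENNReal.ofReal (1 - w) *
            ∫⁻ y, S.indicator 1 (x + (2 : ℝ) • y) ∂unif μ K := by
          gcongr
          refine le_trans ?_ (hK.lintegral_unif_two_ge hS hx)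
          rw [hc, ENNReal.ofReal_div_of_pos (by positivity)]
          gcongr
      _ = ∫⁻ y, h (x + (2 : ℝ) • y) ∂unif μ K := by
          simp only [h]
          rw [lintegral_add_left measurable_const,
            lintegral_const_mul' _ _ ENNReal.ofReal_ne_top]
          simp
      _ ≤ _ := by
          refine lintegral_mono_ae ?_
          filter_upwards [hK.ae_mem_unif (μ := μ)] with y hy
          rw [indicator_of_mem (hmem y hy)]
  have iter : ∀ N : ℕ, ∃ n : ℕ, ∀ S : Set E, MeasurableSet S →
      ENNReal.ofReal θ ≤ ∫⁻ y, S.indicator 1 y ∂unif μ K → ∀ x ∈ K,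
      ENNReal.ofReal (min (1 / 2) (N * (c / 4))) ≤
        (maxAvg (unif μ K))^[n] (S.indicator 1) x := by
    intro N
    induction N with
    | zero => exact ⟨0, fun S _ _ x _ => by simp⟩
    | succ N ih =>
      obtain ⟨n, hn⟩ := ih
      refine ⟨j + n + 1, fun S hS hSθ x hx => le_trans (ENNReal.ofReal_le_ofReal ?_)
        (step S hS hSθ n _ (by positivity) (min_le_left _ _) (hn S hS hSθ) x hx)⟩
      push_cast
      rcases min_cases (1 / 2 : ℝ) (N * (c / 4)) with h | h
      · rw [h.1]; exact (min_le_left _ _).trans (by linarith)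
      · rw [h.1]; exact (min_le_right _ _).trans (by linarith)
  obtain ⟨N, hN⟩ := exists_nat_ge (2 / c)
  obtain ⟨n, hn⟩ := iter N
  refine ⟨n, fun S hS hSθ x hx => le_trans (ENNReal.ofReal_le_ofReal ?_) (hn S hS hSθ x hx)⟩
  rw [div_le_iff₀ hc0] at hN
  exact le_min le_rfl (by linarith)

/-- Affine covariance of the operator makes k independent of the centre and the radius. -/
lemma exists_iterate_ge_half_dilate (hd : finrank ℝ E ≤ 2) {θ : ℝ} (hθ : 0 < θ) (hθ1 : θ ≤ 1) :
    ∃ k : ℕ, ∀ S : Set E, MeasurableSet S → ∀ (x₀ : E) (r : ℝ), 0 < r →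
      ENNReal.ofReal θ ≤ ∫⁻ y, S.indicator 1 (x₀ + r • y) ∂unif μ K →
      ∀ x ∈ x₀ +ᵥ r • K, ENNReal.ofReal (1 / 2) ≤ (maxAvg (unif μ K))^[k] (S.indicator 1) x := by
  obtain ⟨k, hk⟩ := hK.exists_iterate_ge_half (μ := μ) hd hθ hθ1
  refine ⟨k, fun S hS x₀ r hr hSθ x hx => ?_⟩
  obtain ⟨y, hy, rfl⟩ := mem_dilate.1 hx
  have hS' : MeasurableSet ((fun y => x₀ + r • y) ⁻¹' S) :=
    (by fun_prop : Measurable fun y : E => x₀ + r • y) hS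
  exact (hk _ hS' hSθ y hy).trans (maxAvg_iterate_comp_affine _ (S.indicator 1) x₀ hr k y)

/-- The superlevel sets of the iterated maximal function of an indicator are larger than the set
by an arbitrarily large prescribed factor. -/
lemma exists_iterate_measure_ge (hd0 : finrank ℝ E ≠ 0) (hd : finrank ℝ E ≤ 2) {A : ℝ}
    (hA : 0 < A) :
    ∃ k : ℕ, ∀ S : Set E, MeasurableSet S → μ S ≠ ∞ →
      ENNReal.ofReal A * μ S ≤
        μ {x | ENNReal.ofReal (1 / 4) < (maxAvg (unif μ K))^[k] (S.indicator 1) x} := by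
  -- The second entry gives A θ 5^d ≤ 1 for the covering count; the first keeps θ below 1, so that
  -- almost every point of S lies in T.
  set θ : ℝ := min (1 / 2) (A * 5 ^ finrank ℝ E)⁻¹ with hθ
  have hθ0 : 0 < θ := by positivity
  have hθ2 : θ ≤ 1 / 2 := min_le_left _ _
  obtain ⟨k, hk⟩ := hK.exists_iterate_ge_half_dilate (μ := μ) hd hθ0 (by linarith)
  refine ⟨k, fun S hS hSfin => ?_⟩
  have hθne : ENNReal.ofReal θ ≠ 0 := by simpa using hθ0
  set T := {x ∈ S | ENNReal.ofReal θ < maxAvg (unif μ K) (S.indicator 1) x} with hT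
  have hST : μ S ≤ μ T := by
    refine measure_mono_ae ?_
    filter_upwards [hK.ae_le_maxAvg (μ := μ) (measurable_one.indicator hS)] with x hx hxS
    refine ⟨hxS, lt_of_lt_of_le ?_ hx⟩
    rw [indicator_of_mem hxS]
    exact ENNReal.ofReal_lt_one.2 (by linarith)
  set R := max 1 (μ S / (ENNReal.ofReal θ * μ K)).toReal with hR
  have hbound : ∀ (x : E) (r : ℝ), 0 < r →
      ENNReal.ofReal θ ≤ ∫⁻ y, S.indicator 1 (x + r • y) ∂unif μ K → r ≤ R := by
    intro x r hr h
    refine le_max_of_ofReal_pow_mul_le hd0 (mul_ne_zero hθne hK.measure_ne_zero)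
      (ENNReal.mul_ne_top ENNReal.ofReal_ne_top hK.measure_ne_top) hSfin ?_
    rw [lintegral_unif_indicator hS x hr] at h
    have := ENNReal.mul_le_of_le_div h
    rw [measure_dilate x hr.le] at this
    refine le_trans (le_of_eq (by ring)) (this.trans (measure_mono inter_subset_left))
  -- A radius beyond half the supremum of admissible radii: density at least θ at r, but below θ
  -- from 2r on, in particular at 5r.
  have hex : ∀ x, ∃ r : ℝ, x ∈ T → 0 < r ∧
      ENNReal.ofReal θ ≤ ∫⁻ y, S.indicator 1 (x + r • y) ∂unif μ K ∧
      ∀ r', 2 * r ≤ r' → ∫⁻ y, S.indicator 1 (x + r' • y) ∂unif μ K < ENNReal.ofReal θ := by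
    intro x
    by_cases hx : x ∈ T
    · set Q := {r : ℝ | 0 < r ∧ ENNReal.ofReal θ ≤ ∫⁻ y, S.indicator 1 (x + r • y) ∂unif μ K}
        with hQ
      obtain ⟨r₀, hr₀, h₀⟩ : ∃ r : ℝ, ∃ _ : 0 < r,
          ENNReal.ofReal θ < ∫⁻ y, S.indicator 1 (x + r • y) ∂unif μ K := by
        simpa only [maxAvg, lt_iSup_iff] using hx.2
      have hbdd : BddAbove Q := ⟨R, fun r hr => hbound x r hr.1 hr.2⟩
      have hmem : r₀ ∈ Q := ⟨hr₀, h₀.le⟩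
      have hsup : 0 < sSup Q := hr₀.trans_le (le_csSup hbdd hmem)
      obtain ⟨r, hr, hlt⟩ := exists_lt_of_lt_csSup ⟨r₀, hmem⟩ (half_lt_self hsup)
      refine ⟨r, fun _ => ⟨hr.1, hr.2, fun r' hr' => ?_⟩⟩
      by_contra! hcon
      have := le_csSup hbdd (show r' ∈ Q from ⟨by linarith [hr.1], hcon⟩)
      linarith
    · exact ⟨0, fun h => absurd h hx⟩
  choose r hr using hex
  obtain ⟨u, huT, hcount, hdisj, hcov⟩ := hK.exists_disjoint_covering T r (fun x hx => (hr x hx).1)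
    (fun x hx => hbound x (r x) (hr x hx).1 (hr x hx).2.1)
  have hAθ : ENNReal.ofReal A * (ENNReal.ofReal θ * ENNReal.ofReal (5 ^ finrank ℝ E)) ≤ 1 := by
    rw [← ENNReal.ofReal_mul hθ0.le, ← ENNReal.ofReal_mul hA.le]
    refine ENNReal.ofReal_le_one.2 ?_
    have : θ ≤ (A * 5 ^ finrank ℝ E)⁻¹ := min_le_right _ _
    calc A * (θ * 5 ^ finrank ℝ E) = θ * (A * 5 ^ finrank ℝ E) := by ring
      _ ≤ (A * 5 ^ finrank ℝ E)⁻¹ * (A * 5 ^ finrank ℝ E) := by gcongr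
      _ = 1 := inv_mul_cancel₀ (by positivity)
  calc ENNReal.ofReal A * μ S
      ≤ ENNReal.ofReal A * ∑' x : u, μ (S ∩ ((x : E) +ᵥ (5 * r x) • K)) := by
        gcongr
        refine hST.trans (le_trans (measure_mono fun x hx => ?_) 
          (measure_biUnion_le μ hcount fun x => S ∩ (x +ᵥ (5 * r x) • K)))
        obtain ⟨z, hz, hxz⟩ := mem_iUnion₂.1 (hcov hx)
        exact mem_iUnion₂.2 ⟨z, hz, hx.1, hxz⟩
    _ ≤ ENNReal.ofReal A * ∑' x : u, (ENNReal.ofReal θ * ENNReal.ofReal (5 ^ finrank ℝ E)) *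
          μ ((x : E) +ᵥ r x • K) := by
        gcongr with x
        have hx := hr x (huT x.2)
        have h5 : 0 < 5 * r x := by linarith [hx.1]
        have h := hx.2.2 (5 * r x) (by linarith [hx.1])
        rw [lintegral_unif_indicator hS _ h5] at h
        have h' := (ENNReal.div_le_iff (hK.measure_dilate_ne_zero _ h5)
          (hK.measure_dilate_ne_top _ _)).1 h.le
        rwa [measure_dilate_five _ hx.1.le, ← mul_assoc] at h'
    _ ≤ ∑' x : u, μ ((x : E) +ᵥ r x • K) := by
        rw [ENNReal.tsum_mul_left, ← mul_assoc]
        exact mul_le_of_le_one_left' hAθ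
    _ = μ (⋃ x ∈ u, x +ᵥ r x • K) :=
        (measure_biUnion hcount hdisj fun x _ => hK.measurableSet_dilate x _).symm
    _ ≤ _ := by
        refine measure_mono (iUnion₂_subset fun z hz x hx => ?_)
        have hz' := hr z (huT hz)
        refine lt_of_lt_of_le ?_ (hk S hS z (r z) hz'.1 hz'.2.1 x hx)
        exact (ENNReal.ofReal_lt_ofReal_iff (by norm_num)).2 (by norm_num)

/-- Iterating the maximal operator sufficiently often doubles the `L^p` norm. -/
lemma exists_iterate_lintegral_ge (hd0 : finrank ℝ E ≠ 0) (hd : finrank ℝ E ≤ 2) {p : ℝ}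
    (hp : 0 < p) :
    ∃ k : ℕ, ∀ f : E → ℝ≥0∞, Measurable f → ∫⁻ x, f x ^ p ∂μ ≠ ∞ →
      2 ^ p * ∫⁻ x, f x ^ p ∂μ ≤ ∫⁻ x, (maxAvg (unif μ K))^[k] f x ^ p ∂μ := by
  -- On S = {f > 4t} the function f dominates 4t, so level 1/4 for the indicator becomes level t for
  -- f. The rescaling costs 4^p, and 8^p / 4^p = 2^p.
  obtain ⟨k, hk⟩ := hK.exists_iterate_measure_ge (μ := μ) hd0 hd
    (A := 8 ^ p) (by positivity)
  refine ⟨k, fun f hf hfin => ?_⟩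
  have hMk : Measurable ((maxAvg (unif μ K))^[k] f) := by
    cases k with
    | zero => exact hf
    | succ k => rw [Function.iterate_succ_apply']; exact hK.measurable_maxAvg _
  have hf4 : Measurable fun x => 4⁻¹ * f x := hf.const_mul _
  have h84 : ENNReal.ofReal (8 ^ p) * (4⁻¹ : ℝ≥0∞) ^ p = 2 ^ p := by
    rw [← ENNReal.ofReal_rpow_of_pos (by norm_num), ← ENNReal.mul_rpow_of_nonneg _ _ hp.le]
    congr 1
    rw [ENNReal.ofReal_ofNat, ← div_eq_mul_inv, eq_comm,
      ENNReal.eq_div_iff (by simp) (by simp)]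
    norm_num
  calc 2 ^ p * ∫⁻ x, f x ^ p ∂μ = ENNReal.ofReal (8 ^ p) * ∫⁻ x, (4⁻¹ * f x) ^ p ∂μ := by
        simp only [ENNReal.mul_rpow_of_nonneg _ _ hp.le]
        rw [lintegral_const_mul _ (hf.pow_const p), ← mul_assoc, h84]
    _ = ∫⁻ t in Ioi (0 : ℝ), ENNReal.ofReal (8 ^ p) * (μ {x | ENNReal.ofReal t < 4⁻¹ * f x} *
          ENNReal.ofReal (p * t ^ (p - 1))) := by
        rw [lintegral_rpow_eq_lintegral_measure_lt μ hf4 hp,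
          lintegral_const_mul' _ _ ENNReal.ofReal_ne_top]
    _ ≤ ∫⁻ t in Ioi (0 : ℝ), μ {x | ENNReal.ofReal t < (maxAvg (unif μ K))^[k] f x} *
          ENNReal.ofReal (p * t ^ (p - 1)) := by
        refine lintegral_mono_ae ?_
        filter_upwards [ae_restrict_mem measurableSet_Ioi] with t ht
        have ht : 0 < t := ht
        have ht0 : ENNReal.ofReal t ≠ 0 := by simpa using ht
        rw [← mul_assoc]
        gcongr
        set S := {x | ENNReal.ofReal t < 4⁻¹ * f x} with hS
        have hSm : MeasurableSet S := measurableSet_lt measurable_const hf4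
        have hS4 : ∀ x ∈ S, ENNReal.ofReal (4 * t) ≤ f x := by
          intro x hx
          have hx : ENNReal.ofReal t < 4⁻¹ * f x := hx
          rw [mul_comm, ← div_eq_mul_inv, ENNReal.lt_div_iff_mul_lt (by simp) (by simp)] at hx
          rw [mul_comm, ENNReal.ofReal_mul ht.le, ENNReal.ofReal_ofNat]
          exact hx.le
        have hSfin : μ S ≠ ∞ := by
          have h4t : ENNReal.ofReal (4 * t) ^ p ≠ 0 := by
            simp [ENNReal.rpow_eq_zero_iff, ht, hp.le]
          refine ne_top_of_le_ne_top ?_ (measure_mono (t := {x | ENNReal.ofReal (4 * t) ^ p ≤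
            f x ^ p}) fun x hx => ENNReal.rpow_le_rpow (hS4 x hx) hp.le)
          exact ne_top_of_le_ne_top (ENNReal.div_ne_top hfin h4t) (meas_ge_le_lintegral_div
            (hf.pow_const p).aemeasurable h4t (ENNReal.rpow_ne_top_of_nonneg hp.le
              ENNReal.ofReal_ne_top))
        refine (hk S hSm hSfin).trans (measure_mono fun x hx => ?_)
        have hle : (fun y => ENNReal.ofReal (4 * t) * S.indicator 1 y) ≤ f := by
          intro y
          by_cases hy : y ∈ S
          · simpa [hy] using hS4 y hy
          · simp [hy]
        have h := (maxAvg_mono (unif μ K)).iterate k hle x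
        rw [maxAvg_iterate_const_mul _ ENNReal.ofReal_ne_top] at h
        refine lt_of_lt_of_le ?_ h
        calc ENNReal.ofReal t = ENNReal.ofReal (4 * t) * ENNReal.ofReal (1 / 4) := by
              rw [← ENNReal.ofReal_mul (by positivity)]; congr 1; ring
          _ < _ := by
              refine (ENNReal.mul_lt_mul_iff_right ?_ ENNReal.ofReal_ne_top).2 hx
              simpa using ht
    _ = _ := (lintegral_rpow_eq_lintegral_measure_lt μ hMk hp).symm

end IsSymmBody

end Growth

/-! ### Stability of iterates and the lower bound. -/

section LowerBound

variable {E : Type*} [NormedAddCommGroup E] [InnerProductSpace ℝ E] [FiniteDimensional ℝ E]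
  [MeasurableSpace E] [BorelSpace E] {μ : Measure E} [μ.IsAddHaarMeasure] {K : Set E}

namespace IsSymmBody

variable (hK : IsSymmBody K)
include hK

/-- If `M f ≤ f + g` then the iterates of `M` move `f` by at most a multiple of `g` in `L^p`. -/
lemma exists_iterate_le_add (hd0 : finrank ℝ E ≠ 0) {p : ℝ} (hp : 1 < p) (k : ℕ) :
    ∃ D : ℝ≥0∞, D ≠ ∞ ∧ ∀ f g : E → ℝ≥0∞, Measurable f → Measurable g →
      (∀ x, maxAvg (unif μ K) f x ≤ f x + g x) →
      ∃ h : E → ℝ≥0∞, Measurable h ∧ (∀ x, (maxAvg (unif μ K))^[k] f x ≤ f x + h x) ∧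
        ∫⁻ x, h x ^ p ∂μ ≤ D * ∫⁻ x, g x ^ p ∂μ := by
  obtain ⟨C, hC, hstrong⟩ := hK.strong_type (μ := μ) hd0 hp
  induction k with
  | zero =>
    refine ⟨0, ENNReal.zero_ne_top, fun f g _ _ _ => ⟨0, measurable_zero, fun x => ?_, ?_⟩⟩
    · simp
    · simp [ENNReal.zero_rpow_of_pos (by linarith : 0 < p)]
  | succ k ih =>
    obtain ⟨D, hD, ih⟩ := ih
    refine ⟨2 ^ (p - 1) * (1 + C * D), ?_, fun f g hf hg hfg => ?_⟩
    · exact ENNReal.mul_ne_top (ENNReal.rpow_ne_top_of_nonneg (by linarith) (by simp))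
        (ENNReal.add_ne_top.2 ⟨ENNReal.one_ne_top, ENNReal.mul_ne_top hC hD⟩)
    obtain ⟨h, hh, hle, hInt⟩ := ih f g hf hg hfg
    -- The error recursion comes from M(f + h) ≤ Mf + Mh ≤ f + g + Mh.
    refine ⟨fun x => g x + maxAvg (unif μ K) h x, hg.add (hK.measurable_maxAvg h), fun x => ?_, ?_⟩
    · rw [Function.iterate_succ_apply']
      calc maxAvg (unif μ K) ((maxAvg (unif μ K))^[k] f) x
          ≤ maxAvg (unif μ K) (fun y => f y + h y) x := maxAvg_mono _ hle x
        _ ≤ maxAvg (unif μ K) f x + maxAvg (unif μ K) h x := maxAvg_add_le _ hf h x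
        _ ≤ f x + g x + maxAvg (unif μ K) h x := by gcongr; exact hfg x
        _ = _ := add_assoc _ _ _
    · calc ∫⁻ x, (g x + maxAvg (unif μ K) h x) ^ p ∂μ
          ≤ ∫⁻ x, 2 ^ (p - 1) * (g x ^ p + maxAvg (unif μ K) h x ^ p) ∂μ :=
            lintegral_mono fun x => ENNReal.rpow_add_le_mul_rpow_add_rpow _ _ hp.le
        _ = 2 ^ (p - 1) * (∫⁻ x, g x ^ p ∂μ + ∫⁻ x, maxAvg (unif μ K) h x ^ p ∂μ) := by
            rw [lintegral_const_mul' _ _ (ENNReal.rpow_ne_top_of_nonneg (by linarith) (by simp)),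
              lintegral_add_left (hg.pow_const p)]
        _ ≤ 2 ^ (p - 1) * (∫⁻ x, g x ^ p ∂μ + C * (D * ∫⁻ x, g x ^ p ∂μ)) := by
            gcongr
            exact (hstrong h hh).trans (mul_le_mul_right hInt C)
        _ = _ := by ring

/-- In dimensions one and two the maximal operator increases `∫ f ^ p` by a fixed factor. -/
lemma exists_lintegral_maxAvg_ge (hd0 : finrank ℝ E ≠ 0) (hd : finrank ℝ E ≤ 2) {p : ℝ}
    (hp : 1 < p) :
    ∃ δ : ℝ, 0 < δ ∧ ∀ f : E → ℝ≥0∞, Measurable f → ∫⁻ x, f x ^ p ∂μ ≠ ∞ →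
      ENNReal.ofReal (1 + δ) * ∫⁻ x, f x ^ p ∂μ ≤ ∫⁻ x, maxAvg (unif μ K) f x ^ p ∂μ := by
  have hp0 : 0 < p := by linarith
  obtain ⟨k, hk⟩ := hK.exists_iterate_lintegral_ge (μ := μ) hd0 hd hp0
  obtain ⟨D, hD, hit⟩ := hK.exists_iterate_le_add (μ := μ) hd0 hp k
  refine ⟨(D.toReal + 1)⁻¹, by positivity, fun f hf hfin => ?_⟩
  -- With truncated subtraction Mf ≤ f + g holds everywhere, and equality holds wherever f ≤ Mf,
  -- hence almost everywhere.
  let g : E → ℝ≥0∞ := fun x => maxAvg (unif μ K) f x - f x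
  have hg : Measurable g := (hK.measurable_maxAvg f).sub hf
  obtain ⟨h, hh, hle, hInt⟩ := hit f g hf hg fun x => le_add_tsub
  set I := ∫⁻ x, f x ^ p ∂μ with hI
  set G := ∫⁻ x, g x ^ p ∂μ with hG
  have h2 : (2 : ℝ≥0∞) ^ (p - 1) ≠ 0 := by simp [ENNReal.rpow_eq_zero_iff]
  have h2' : (2 : ℝ≥0∞) ^ (p - 1) ≠ ∞ := ENNReal.rpow_ne_top_of_nonneg (by linarith) (by simp)
  have hupper : 2 ^ p * I ≤ 2 ^ (p - 1) * (I + D * G) := by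
    calc 2 ^ p * I ≤ ∫⁻ x, (maxAvg (unif μ K))^[k] f x ^ p ∂μ := hk f hf hfin
      _ ≤ ∫⁻ x, 2 ^ (p - 1) * (f x ^ p + h x ^ p) ∂μ :=
          lintegral_mono fun x => (ENNReal.rpow_le_rpow (hle x) hp0.le).trans
            (ENNReal.rpow_add_le_mul_rpow_add_rpow _ _ hp.le)
      _ = 2 ^ (p - 1) * (I + ∫⁻ x, h x ^ p ∂μ) := by
          rw [lintegral_const_mul' _ _ h2', lintegral_add_left (hf.pow_const p)]
      _ ≤ _ := by gcongr
  -- Dividing by 2^(p-1) leaves 2I ≤ I + DG, and I is finite, so it can be cancelled.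
  have hIG : I ≤ D * G := by
    have h3 : (2 : ℝ≥0∞) ^ p = 2 ^ (p - 1) * 2 := by
      conv_rhs => rw [← ENNReal.rpow_one 2, ← ENNReal.rpow_mul, one_mul]
      rw [← ENNReal.rpow_add _ _ (by simp) (by simp), sub_add_cancel]
    rw [h3, mul_assoc, ENNReal.mul_le_mul_iff_right h2 h2', two_mul] at hupper
    exact (ENNReal.add_le_add_iff_left hfin).1 hupper
  have hδ : ENNReal.ofReal (D.toReal + 1)⁻¹ * I ≤ G := by
    calc ENNReal.ofReal (D.toReal + 1)⁻¹ * I ≤ ENNReal.ofReal (D.toReal + 1)⁻¹ * (D * G) := by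
          gcongr
      _ = (ENNReal.ofReal (D.toReal + 1)⁻¹ * ENNReal.ofReal D.toReal) * G := by
          rw [ENNReal.ofReal_toReal hD, mul_assoc]
      _ ≤ 1 * G := by
          gcongr
          rw [← ENNReal.ofReal_mul (by positivity)]
          refine ENNReal.ofReal_le_one.2 ?_
          rw [inv_mul_le_iff₀ (by positivity)]
          linarith
      _ = G := one_mul G
  calc ENNReal.ofReal (1 + (D.toReal + 1)⁻¹) * I
      = I + ENNReal.ofReal (D.toReal + 1)⁻¹ * I := by
        rw [ENNReal.ofReal_add zero_le_one (by positivity), add_mul, ENNReal.ofReal_one, one_mul]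
    _ ≤ I + G := by gcongr
    _ = ∫⁻ x, f x ^ p + g x ^ p ∂μ := (lintegral_add_left (hf.pow_const p) _).symm
    _ ≤ _ := by
        refine lintegral_mono_ae ?_
        filter_upwards [hK.ae_le_maxAvg (μ := μ) hf] with x hx
        refine (ENNReal.add_rpow_le_rpow_add _ _ hp.le).trans (le_of_eq ?_)
        rw [add_tsub_cancel_of_le hx]

end IsSymmBody

end LowerBound

/-! ### Transfer to convex bodies and `eLpNorm`. -/

lemma centeredMaximal_eq_maxAvg {d : ℕ} (K : Set (EuclideanSpace ℝ (Fin d)))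
    (f : EuclideanSpace ℝ (Fin d) → ℝ≥0∞) :
    centeredMaximal K f = maxAvg (unif volume K) f := by
  funext x
  refine iSup_congr fun r => iSup_congr fun hr => ?_
  rw [lintegral_unif _ _ hr, setLAverage_eq, ENNReal.div_eq_inv_mul]

/-- The origin is the midpoint of the interior points x and -x, and the interior is convex. -/
lemma ConvexBody.isSymmBody {E : Type*} [NormedAddCommGroup E] [InnerProductSpace ℝ E]
    (K : ConvexBody E) (hInt : (interior (K : Set E)).Nonempty) (hsymm : ∀ x ∈ K, -x ∈ K) :
    IsSymmBody (K : Set E) where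
  convex := K.convex
  compact := K.isCompact
  symm := hsymm
  mem_nhds := by
    obtain ⟨x, hx⟩ := hInt
    have hneg : -x ∈ interior (K : Set E) := by
      have hpre : Neg.neg ⁻¹' (K : Set E) = K := by
        ext y
        exact ⟨fun h => by simpa using hsymm _ h, fun h => hsymm _ h⟩
      have h := (Homeomorph.neg E).preimage_interior (K : Set E)
      simp only [Homeomorph.coe_neg, hpre] at h
      have hx' := hx
      rw [← h] at hx'
      exact hx'
    have h0 := K.convex.interior hx hneg (by norm_num : (0 : ℝ) ≤ 1 / 2)
      (by norm_num : (0 : ℝ) ≤ 1 / 2) (by norm_num)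
    rw [smul_neg, add_neg_cancel] at h0
    exact mem_interior_iff_mem_nhds.1 h0

theorem theorem1 (d : ℕ) (hd : d = 1 ∨ d = 2)
    (K : ConvexBody (EuclideanSpace ℝ (Fin d)))
    (hK_int : (interior (K : Set (EuclideanSpace ℝ (Fin d)))).Nonempty)
    (hK_symm : ∀ x ∈ K, -x ∈ K)
    (p : ℝ≥0∞) (hp_one : 1 < p) (hp_top : p < ∞) :
    ∃ ε : ℝ, 0 < ε ∧
      ∀ f : EuclideanSpace ℝ (Fin d) → ℝ, MemLp f p volume →
        ENNReal.ofReal (1 + ε) * eLpNorm f p volume ≤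
          eLpNorm (centeredMaximal (K : Set (EuclideanSpace ℝ (Fin d)))
            (fun y => ‖f y‖ₑ)) p volume := by
  have hK := K.isSymmBody hK_int hK_symm
  have hp0 : p ≠ 0 := (zero_lt_one.trans hp_one).ne'
  have hq1 : 1 < p.toReal := by
    simpa using (ENNReal.toReal_lt_toReal ENNReal.one_ne_top hp_top.ne).2 hp_one
  set q := p.toReal with hq
  have hq0 : 0 < q := by linarith
  have hfr : finrank ℝ (EuclideanSpace ℝ (Fin d)) = d := finrank_euclideanSpace_fin
  obtain ⟨δ, hδ, hmain⟩ := hK.exists_lintegral_maxAvg_ge (μ := volume)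
    (by rw [hfr]; omega) (by rw [hfr]; omega) hq1
  -- The gain 1 + δ concerns the integral of the q-th power, so the norm gains its q-th root.
  refine ⟨(1 + δ) ^ (1 / q) - 1, sub_pos.2 (Real.one_lt_rpow (by linarith) (by positivity)),
    fun f hf => ?_⟩
  have hfm : AEMeasurable (fun y => ‖f y‖ₑ) volume := hf.1.enorm
  -- Averages ignore null sets, so a measurable modification has the same maximal function at every
  -- point.
  set F := hfm.mk _ with hF
  have hFm : Measurable F := hfm.measurable_mk
  have hfF : (fun y => ‖f y‖ₑ) =ᵐ[volume] F := hfm.ae_eq_mk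
  have hInt : ∫⁻ x, ‖f x‖ₑ ^ q = ∫⁻ x, F x ^ q := by
    refine lintegral_congr_ae ?_
    filter_upwards [hfF] with x hx
    rw [← hx]
  have hmax : centeredMaximal (K : Set (EuclideanSpace ℝ (Fin d))) (fun y => ‖f y‖ₑ)
      = maxAvg (unif volume K) F := by
    rw [centeredMaximal_eq_maxAvg]
    exact le_antisymm (maxAvg_mono_ae hfF.le) (maxAvg_mono_ae hfF.symm.le)
  have hfin : ∫⁻ x, F x ^ q ≠ ∞ := by
    rw [← hInt]
    exact (lintegral_rpow_enorm_lt_top_of_eLpNorm_lt_top hp0 hp_top.ne hf.2).ne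
  rw [eLpNorm_eq_lintegral_rpow_enorm_toReal hp0 hp_top.ne,
    eLpNorm_eq_lintegral_rpow_enorm_toReal hp0 hp_top.ne, hmax, ← hq, hInt, add_sub_cancel,
    ← ENNReal.ofReal_rpow_of_pos (by linarith), ← ENNReal.mul_rpow_of_nonneg _ _ (by positivity)]
  refine ENNReal.rpow_le_rpow ?_ (by positivity)
  simpa using hmain F hFm hfin
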